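/- **Theorem 3.4.** Let $d\ge 1$, let $\mathcal S_d^+$ be the set of real symmetric positive definite $d\times d$ matrices, $\mathcal{G}l_d$ the set of invertible $d\times d$ matrices, $u^{1/2}$ the principal square root, $\beta'$ the transpose of $\beta$, $I$ the identity matrix, and $\nu_{m,\sigma}$ the Gaussian law on $\mathbb R^d$ with mean $m$ and covariance $\sigma$. Fix $m,\overline m\in\mathbb R^d$ and $\sigma,\overline\sigma\in\mathcal S_d^+$. For $\theta=(\alpha,\beta,\tau)\in\Theta:=\mathbb R^d\times \mathcal{G}l_d\times\mathcal S_d^+$ let $K_\theta(x,dy)$ be the law of $\alpha+\beta x+\tau^{1/2}G$, with $G\sim\nu_{0,I}$, let $P_\theta(d(x,y)):=\nu_{m,\sigma}(dx)\,K_\theta(x,dy)$, and let $$\mathbb S(\theta):=\mathrm{argmin}\left\{\mathrm{Ent}(P_{\theta_1}\,|\,P_\theta)~:~\theta_1=(\alpha_1,\beta_1,\tau_1)\in\Theta,\ \alpha_1+\beta_1 m=\overline m,\ \beta_1\sigma\beta_1'+\tau_1=\overline\sigma\right\},$$ where $\mathrm{Ent}$ is the relative entropy. Define the entropic cost $$H(P_{\theta_1}\,|\,P_\theta):=\mathrm{Ent}(P_{\theta_1}\,|\,P_\theta)+\int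 (\nu_{m,\sigma}K_{\theta_1})(dy)\,V(y),\qquad V:=-\log\frac{d\nu_{\overline m,\overline\sigma}}{dy}.$$ Put $\gamma_\theta:=\overline\sigma^{1/2}\tau^{-1}\beta\,\sigma^{1/2}$, $\varpi_\theta:=(\gamma_\theta\gamma_\theta')^{-1}$ and $$r_\theta:=-\frac{\varpi_\theta}{2}+\left(\varpi_\theta+\left(\frac{\varpi_\theta}{2}\right)^2\right)^{1/2},\qquad \varsigma_\theta:=\overline\sigma^{1/2}\,r_\theta\,\overline\sigma^{1/2},$$ and let $u\,\sharp\, v:=v^{1/2}(v^{-1/2}\,u\,v^{-1/2})^{1/2}v^{1/2}$ for $u,v\in\mathcal S_d^+$. Let $\mathbb W_2$ be the quadratic Wasserstein distance for the Euclidean norm. Fix $\alpha\in\mathbb R^d$ and $\beta\in\mathcal{G}l_d$, and set $\sigma_\beta:=\beta\sigma\beta'$ and $\theta(t):=(\alpha,\beta,tI)$ for $t>0$. For every $t>0$ the minimizer $\mathbb S(\theta(t))$ exists and is unique, the quantities below are finite, and $$t\,H\left(P_{\mathbb S(\theta(t))}\,|\,P_{\theta(t)}\right)-\frac12\,\mathbb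 W_2\left(\nu_{\overline m,\overline\sigma},\nu_{\alpha+\beta m,\sigma_\beta}\right)^2 =\mathrm{Tr}\left(\left((\overline\sigma\,\sharp\,\sigma_\beta^{-1})-\frac{\varsigma_{\theta(t)}}{t}\right)\sigma_\beta\right)+\frac t2\left(d\log(2\pi)-\log\det\left(\frac{r_{\theta(t)}}{t}\right)\right).$$ In addition, there exist constants $c<\infty$ and $t_0>0$ such that for all $0<t\le t_0$ $$\left|\,t\,H\left(P_{\mathbb S(\theta(t))}\,|\,P_{\theta(t)}\right)-\frac12\,\mathbb W_2\left(\nu_{\overline m,\overline\sigma},\nu_{\alpha+\beta m,\sigma_\beta}\right)^2\right|\le c\,t.$$ -/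

import Mathlib

open MeasureTheory ProbabilityTheory Matrix
open scoped MatrixOrder ENNReal

namespace GaussianBridge

/-- Euclidean space `ℝ^d`. -/
abbrev E (d : ℕ) : Type := EuclideanSpace ℝ (Fin d)

/-- Square real matrices of size `d`. -/
abbrev Mat (d : ℕ) : Type := Matrix (Fin d) (Fin d) ℝ

/-- The matrix `β` acting on the Euclidean vector `x`. -/
noncomputable def act {d : ℕ} (β : Mat d) (x : E d) : E d :=
  Matrix.toEuclideanCLM (𝕜 := ℝ) β x

/-- The parameter space `Θ = ℝ^d × GL_d × S_d^+`. -/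
@[ext]
structure Param (d : ℕ) where
  α : E d
  β : Mat d
  τ : Mat d
  isUnit_β : IsUnit β
  posDef_τ : τ.PosDef

/-- The reference parameter `θ(t) = (α, β, t I)`, for `t > 0`. -/
def refParam {d : ℕ} (α : E d) (β : Mat d) (hβ : IsUnit β) (t : ℝ) (ht : 0 < t) : Param d where
  α := α
  β := β
  τ := t • (1 : Mat d)
  isUnit_β := hβ
  posDef_τ := Matrix.PosDef.one.smul ht

/-! ### Probability measures -/

/-- The transition `K_θ(x, dy)`: the law of `α + β x + τ^{1/2} G` with `G` standard Gaussian. -/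
noncomputable def kernel {d : ℕ} (θ : Param d) : Kernel (E d) (E d) where
  toFun x := multivariateGaussian (θ.α + act θ.β x) θ.τ
  measurable' := by
    have hf : Measurable (fun p : E d × E d ↦
        (θ.α + act θ.β p.1) + Matrix.toEuclideanCLM (𝕜 := ℝ) (CFC.sqrt θ.τ) p.2) := by
      unfold act
      fun_prop
    have h := ((Kernel.id ×ₖ Kernel.const (E d) (stdGaussian (E d))).map (fun p : E d × E d ↦
        (θ.α + act θ.β p.1) +
          Matrix.toEuclideanCLM (𝕜 := ℝ) (CFC.sqrt θ.τ) p.2)).measurable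
    convert! h using 1
    funext x
    rw [Kernel.map_apply _ hf, Kernel.prod_apply, Kernel.id_apply, Kernel.const_apply,
      Measure.dirac_prod, Measure.map_map hf (by fun_prop)]
    rfl

instance {d : ℕ} (θ : Param d) : IsMarkovKernel (kernel θ) :=
  ⟨fun x ↦ inferInstanceAs (IsProbabilityMeasure (multivariateGaussian (θ.α + act θ.β x) θ.τ))⟩

/-- `P_θ = ν_{m,σ} × K_θ`, i.e. `P_θ(d(x,y)) = ν_{m,σ}(dx) K_θ(x,dy)`. -/
noncomputable def jointLaw {d : ℕ} (m : E d) (σ : Mat d) (θ : Param d) : Measure (E d × E d) :=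
  multivariateGaussian m σ ⊗ₘ kernel θ

/-- `Ω_{m,σ}(m̄,σ̄)`: the parameters `(α, β, τ)` with `α + β m = m̄` and `β σ β' + τ = σ̄`. -/
def admissible {d : ℕ} (m : E d) (σ : Mat d) (mbar : E d) (σbar : Mat d) : Set (Param d) :=
  {θ | θ.α + act θ.β m = mbar ∧ θ.β * σ * θ.βᵀ + θ.τ = σbar}

/-- The set of minimizers defining the Schrödinger bridge map:
`argmin { Ent(P_{θ₁} | P_θ) : θ₁ ∈ Ω_{m,σ}(m̄,σ̄) }`. -/
def bridgeArgmin {d : ℕ} (m : E d) (σ : Mat d) (mbar : E d) (σbar : Mat d) (θ : Param d) :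
    Set (Param d) :=
  {θ₁ | θ₁ ∈ admissible m σ mbar σbar ∧
    IsMinOn (fun θ₂ ↦ InformationTheory.klDiv (jointLaw m σ θ₂) (jointLaw m σ θ))
      (admissible m σ mbar σbar) θ₁}

/-- The potential `V = - log (dμ/dy)` of a measure `μ` with a density with respect to the Lebesgue
measure. -/
noncomputable def potential {d : ℕ} (μ : Measure (E d)) (y : E d) : ℝ :=
  - Real.log (μ.rnDeriv volume y).toReal

/-- The entropic cost
`H(P_{θ₁} | P_θ) = Ent(P_{θ₁} | P_θ) + ∫ (ν_{m,σ} K_{θ₁})(dy) V(y)`,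
where `e^{-V}` is the density of `ν_{m̄,σ̄}`. -/
noncomputable def entropicCost {d : ℕ} (m : E d) (σ : Mat d) (mbar : E d) (σbar : Mat d)
    (θ₁ θ : Param d) : ℝ :=
  (InformationTheory.klDiv (jointLaw m σ θ₁) (jointLaw m σ θ)).toReal +
    ∫ y, potential (multivariateGaussian mbar σbar) y ∂(kernel θ₁ ∘ₘ multivariateGaussian m σ)

/-- The `p`-th Wasserstein distance between `μ` and `ν`, as an extended nonnegative number:
the infimum over the couplings of `μ` and `ν` of `(∫ ‖x - y‖^p π(d(x,y)))^{1/p}`. -/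
noncomputable def wasserstein {d : ℕ} (p : ℝ) (μ ν : Measure (E d)) : ℝ≥0∞ :=
  ⨅ (π : Measure (E d × E d)) (_ : π.fst = μ ∧ π.snd = ν),
    (∫⁻ z, edist z.1 z.2 ^ p ∂π) ^ (1 / p)

/-! ### Matrices -/

/-- The geometric mean `u ♯ v = v^{1/2} (v^{-1/2} u v^{-1/2})^{1/2} v^{1/2}`. -/
noncomputable def geomMean {d : ℕ} (u v : Mat d) : Mat d :=
  CFC.sqrt v * CFC.sqrt ((CFC.sqrt v)⁻¹ * u * (CFC.sqrt v)⁻¹) * CFC.sqrt v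

/-- `γ_θ = σ̄^{1/2} τ^{-1} β σ^{1/2}`. -/
noncomputable def gammaMat {d : ℕ} (σ σbar : Mat d) (θ : Param d) : Mat d :=
  CFC.sqrt σbar * (θ.τ⁻¹ * θ.β) * CFC.sqrt σ

/-- `ϖ_θ`, determined by `ϖ_θ^{-1} = γ_θ γ_θ'`. -/
noncomputable def varpi {d : ℕ} (σ σbar : Mat d) (θ : Param d) : Mat d :=
  (gammaMat σ σbar θ * (gammaMat σ σbar θ)ᵀ)⁻¹

/-- `r_θ = - ϖ_θ / 2 + (ϖ_θ + (ϖ_θ / 2)^2)^{1/2}`, the positive definite fixed point of the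
Riccati map `v ↦ (I + (ϖ_θ + v)^{-1})^{-1}`. -/
noncomputable def rMat {d : ℕ} (σ σbar : Mat d) (θ : Param d) : Mat d :=
  -((1 / 2 : ℝ) • varpi σ σbar θ) +
    CFC.sqrt (varpi σ σbar θ + ((1 / 2 : ℝ) • varpi σ σbar θ) ^ 2)

/-- `ς_θ = σ̄^{1/2} r_θ σ̄^{1/2}`. -/
noncomputable def varsigma {d : ℕ} (σ σbar : Mat d) (θ : Param d) : Mat d :=
  CFC.sqrt σbar * rMat σ σbar θ * CFC.sqrt σbar

/-- `σ_β = β σ β'`. -/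
def sigmaBeta {d : ℕ} (σ β : Mat d) : Mat d := β * σ * βᵀ

end GaussianBridge

open GaussianBridge

namespace GaussianBridge

/-! ### Symmetric real matrices -/

section MatrixLemmas

variable {n : Type*} {A B P Q : Matrix n n ℝ}

/-! The marginal constraints determine `α₁` and `τ₁` from `β₁`, so the minimization runs over one
matrix. On admissible parameters the Gaussian entropy is, up to a constant, `-1/2 log det τ₁` minus
a cross term linear in `β₁` (`gaussianEnt_of_admissible`). The Riccati equation for `ς`
(`varsigma_fixed`) says that `τ₁ = ς`, `β₁ = ς τ⁻¹ β` is admissible. The tangent inequality for the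
concave function `log det` at `ς`, followed by completing a square, bounds the entropy excess below
by a positive definite quadratic form in `β₁ - ς τ⁻¹ β` (`gaussianEnt_bridge_add_le`); existence and
uniqueness follow.

The potential term is the same for all admissible parameters. The Wasserstein distance is computed
by duality: with `T = σbar ♯ σ_β⁻¹`, Young's inequality yields quadratic dual potentials, and the
affine map with matrix `T` attains the bound (`wasserstein_two_multivariateGaussian`). The closed
form is then algebra with `τ = t I`.

For the rate, `Y = σ_β^{1/2} (ς/t) σ_β^{1/2}` satisfies `t Y + Y² = Z²`, where `Z = (σ_β^{1/2} σbar
σ_β^{1/2})^{1/2}` is independent of `t`. Sylvester equations give `0 ≤ Z - Y ≤ t I`, so the trace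
term `Tr (Z - Y)` is `O(t)`, while `log det Y` stays bounded for `t ≤ 1`; no expansion of square
roots is needed. -/

lemma transpose_eq_of_isHermitian (hA : A.IsHermitian) : Aᵀ = A := by
  simpa [conjTranspose_eq_transpose_of_trivial] using hA.eq

variable [Fintype n]

lemma posSemidef_mul_mul_transpose {m : Type*} [Fintype m] (hA : A.PosSemidef)
    (B : Matrix m n ℝ) : (B * A * Bᵀ).PosSemidef := by
  simpa [conjTranspose_eq_transpose_of_trivial] using hA.mul_mul_conjTranspose_same B

variable [DecidableEq n]

lemma posDef_sqrt (hA : A.PosDef) : (CFC.sqrt A).PosDef :=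
  ((CFC.sqrt_nonneg A).posSemidef.posDef_iff_isUnit).2
    ((CFC.isUnit_sqrt_iff A hA.posSemidef.nonneg).2 hA.isUnit)

lemma sqrt_mul_self (hA : A.PosDef) : CFC.sqrt A * CFC.sqrt A = A :=
  CFC.sqrt_mul_sqrt_self A hA.posSemidef.nonneg

lemma transpose_sqrt (A : Matrix n n ℝ) : (CFC.sqrt A)ᵀ = CFC.sqrt A :=
  transpose_eq_of_isHermitian (CFC.sqrt_nonneg A).posSemidef.isHermitian

/-- `v ↦ B v Bᵀ` preserves positive definiteness for invertible `B`. -/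
lemma posDef_mul_mul_transpose (hA : A.PosDef) (hB : IsUnit B) : (B * A * Bᵀ).PosDef := by
  have := (Matrix.IsUnit.posDef_star_right_conjugate_iff (x := A) hB).2 hA
  simpa [star_eq_conjTranspose, conjTranspose_eq_transpose_of_trivial] using this

lemma posDef_mul_mul_self (hA : A.PosDef) (hB : B.PosDef) : (B * A * B).PosDef := by
  simpa [transpose_eq_of_isHermitian hB.isHermitian] using
    posDef_mul_mul_transpose hA hB.isUnit

lemma isUnit_det_of_posDef (hA : A.PosDef) : IsUnit A.det :=
  (isUnit_iff_isUnit_det A).1 hA.isUnit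

lemma trace_mul_nonneg (hA : A.PosSemidef) (hB : B.PosSemidef) : 0 ≤ (A * B).trace := by
  have h : (A * B).trace = (CFC.sqrt A * B * (CFC.sqrt A)ᵀ).trace := by
    rw [transpose_sqrt, trace_mul_comm (CFC.sqrt A * B), ← mul_assoc,
      CFC.sqrt_mul_sqrt_self A hA.nonneg]
  rw [h]
  exact (posSemidef_mul_mul_transpose hB _).trace_nonneg

/-- If `Tr (C A Cᵀ B) = 0` with `A` and `B` positive definite, then `C = 0`. -/
lemma eq_zero_of_trace_mul_eq_zero {C : Matrix n n ℝ} (hA : A.PosDef) (hB : B.PosDef)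
    (h : (C * A * Cᵀ * B).trace = 0) : C = 0 := by
  -- The trace is the squared Frobenius norm of `B^{1/2} C A^{1/2}`.
  have h' : ((CFC.sqrt B * C * CFC.sqrt A) * (CFC.sqrt B * C * CFC.sqrt A)ᴴ).trace = 0 := by
    rw [← h, conjTranspose_eq_transpose_of_trivial, transpose_mul, transpose_mul, transpose_sqrt,
      transpose_sqrt]
    calc _ = (CFC.sqrt B * (C * (CFC.sqrt A * CFC.sqrt A) * Cᵀ * CFC.sqrt B)).trace := by
          simp only [mul_assoc]
      _ = (C * A * Cᵀ * (CFC.sqrt B * CFC.sqrt B)).trace := by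
          rw [trace_mul_comm, sqrt_mul_self hA]; simp only [mul_assoc]
      _ = _ := by rw [sqrt_mul_self hB]
  have h0 := trace_mul_conjTranspose_self_eq_zero_iff.1 h'
  have h1 : CFC.sqrt B * C = 0 := (posDef_sqrt hA).isUnit.mul_left_eq_zero.1 h0
  exact (posDef_sqrt hB).isUnit.mul_right_eq_zero.1 h1

lemma log_det_le_trace_sub_card (hA : A.PosDef) :
    Real.log A.det ≤ A.trace - Fintype.card n := by
  have hd := hA.isHermitian.det_eq_prod_eigenvalues
  have ht := hA.isHermitian.trace_eq_sum_eigenvalues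
  simp only [RCLike.ofReal_real_eq_id, id_eq] at hd ht
  rw [hd, ht, Real.log_prod (fun i _ ↦ (hA.eigenvalues_pos i).ne')]
  calc ∑ i, Real.log (hA.isHermitian.eigenvalues i)
      ≤ ∑ i, (hA.isHermitian.eigenvalues i - 1) :=
        Finset.sum_le_sum fun i _ ↦ Real.log_le_sub_one_of_pos (hA.eigenvalues_pos i)
    _ = _ := by simp

/-- Concavity of `log det`, as its tangent inequality at `B`: apply `log x ≤ x - 1` to the
eigenvalues of `B^{-1/2} A B^{-1/2}`. -/
lemma log_det_sub_log_det_le (hA : A.PosDef) (hB : B.PosDef) :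
    Real.log A.det - Real.log B.det ≤ (B⁻¹ * A).trace - Fintype.card n := by
  have hs := posDef_sqrt hB.inv
  have h := log_det_le_trace_sub_card (posDef_mul_mul_self hA hs)
  have ht : (CFC.sqrt B⁻¹ * A * CFC.sqrt B⁻¹).trace = (B⁻¹ * A).trace := by
    rw [trace_mul_comm, ← mul_assoc, sqrt_mul_self hB.inv]
  have hd : (CFC.sqrt B⁻¹ * A * CFC.sqrt B⁻¹).det = A.det * B.det⁻¹ := by
    rw [det_mul, det_mul, mul_comm (det _) A.det, mul_assoc, ← det_mul, sqrt_mul_self hB.inv,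
      det_nonsing_inv, Ring.inverse_eq_inv']
  rw [ht, hd, Real.log_mul hA.det_pos.ne' (inv_ne_zero hB.det_pos.ne'), Real.log_inv] at h
  linarith

/-- A symmetric solution `A` of a Sylvester equation with positive data is positive. -/
lemma posSemidef_of_mul_add_mul (hA : A.IsHermitian) (hPQ : (P + Q).PosDef)
    (h : (A * P + Q * A).PosSemidef) : A.PosSemidef := by
  rw [hA.posSemidef_iff_eigenvalues_nonneg]
  intro i
  -- On an eigenvector of `A` with eigenvalue `λ`, the form of `A P + Q A` equals `λ` times the
  -- positive form of `P + Q`, which fixes the sign of `λ`.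
  set v : n → ℝ := ⇑(hA.eigenvectorBasis i)
  have hv : A *ᵥ v = hA.eigenvalues i • v := hA.mulVec_eigenvectorBasis i
  have hv' : v ᵥ* A = hA.eigenvalues i • v := by
    rw [← mulVec_transpose, transpose_eq_of_isHermitian hA, hv]
  have hv0 : v ≠ 0 := by
    intro h0
    exact hA.eigenvectorBasis.orthonormal.ne_zero i (by ext j; exact congrFun h0 j)
  have h1 := h.dotProduct_mulVec_nonneg v
  have h2 := hPQ.dotProduct_mulVec_pos hv0
  have h3 : star v ⬝ᵥ (A * P + Q * A) *ᵥ v =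
      hA.eigenvalues i * (star v ⬝ᵥ (P + Q) *ᵥ v) := by
    simp only [star_trivial, add_mulVec, dotProduct_add, ← mulVec_mulVec]
    rw [dotProduct_mulVec v A, hv', hv]
    simp [mulVec_smul, mul_add]
  rw [h3] at h1
  exact nonneg_of_mul_nonneg_left h1 h2

/-- The positive root `-w/2 + (w + (w/2)²)^{1/2}` of `r² + w r = w`. -/
noncomputable def riccatiRoot (w : Matrix n n ℝ) : Matrix n n ℝ :=
  -((1 / 2 : ℝ) • w) + CFC.sqrt (w + ((1 / 2 : ℝ) • w) ^ 2)

lemma posDef_add_half_sq {w : Matrix n n ℝ} (hw : w.PosDef) :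
    (w + ((1 / 2 : ℝ) • w) ^ 2).PosDef :=
  hw.add_posSemidef ((hw.posSemidef.smul (by norm_num : (0 : ℝ) ≤ 1 / 2)).pow 2)

lemma commute_sqrt_add_half_sq (w : Matrix n n ℝ) :
    Commute (CFC.sqrt (w + ((1 / 2 : ℝ) • w) ^ 2)) w := by
  rw [CFC.sqrt_eq_cfc]
  refine Commute.cfc_nnreal ?_ _
  exact (Commute.refl w).add_left (((Commute.refl w).smul_left _).pow_left 2)

/-- With `s` the square root, `(s - w/2)(s + w/2) = s² - w²/4 = w`, because `s` commutes with `w`.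
-/
lemma riccatiRoot_mul {w : Matrix n n ℝ} (hw : w.PosDef) :
    riccatiRoot w * (CFC.sqrt (w + ((1 / 2 : ℝ) • w) ^ 2) + (1 / 2 : ℝ) • w) = w := by
  have hs := sqrt_mul_self (posDef_add_half_sq hw)
  have hc := (commute_sqrt_add_half_sq w).eq
  unfold riccatiRoot
  set s := CFC.sqrt (w + ((1 / 2 : ℝ) • w) ^ 2)
  rw [add_mul, mul_add, mul_add, hs]
  simp only [neg_mul, smul_mul_assoc, mul_smul_comm, hc, sq]
  module

lemma posDef_riccatiRoot {w : Matrix n n ℝ} (hw : w.PosDef) : (riccatiRoot w).PosDef := by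
  have hs := posDef_sqrt (posDef_add_half_sq hw)
  have hw2 : ((1 / 2 : ℝ) • w).PosDef := hw.smul (by norm_num)
  have hm := riccatiRoot_mul hw
  have hr : (riccatiRoot w).IsHermitian := hw2.isHermitian.neg.add hs.isHermitian
  have hr0 : (riccatiRoot w).PosSemidef :=
    posSemidef_of_mul_add_mul (Q := 0) hr (by rw [add_zero]; exact hs.add hw2)
      (by rw [zero_mul, add_zero, hm]; exact hw.posSemidef)
  refine hr0.posDef_iff_det_ne_zero.2 fun h0 ↦ hw.det_pos.ne' ?_
  rw [← hm, det_mul, h0, zero_mul]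

/-- This is `r² + w r = w` multiplied by `w⁻¹`. In this form only `w⁻¹ = γ γ'` appears, and
conjugation by `σbar^{1/2}` turns it into the covariance constraint. -/
lemma riccatiRoot_fixed {w : Matrix n n ℝ} (hw : w.PosDef) :
    riccatiRoot w + riccatiRoot w * w⁻¹ * riccatiRoot w = 1 := by
  have hm := riccatiRoot_mul hw
  have hc : Commute (riccatiRoot w) w :=
    (((Commute.refl w).smul_left _).neg_left).add_left (commute_sqrt_add_half_sq w)
  have hs : CFC.sqrt (w + ((1 / 2 : ℝ) • w) ^ 2) + (1 / 2 : ℝ) • w = riccatiRoot w + w := by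
    unfold riccatiRoot
    have : w = (1 / 2 : ℝ) • w + (1 / 2 : ℝ) • w := by rw [← add_smul]; norm_num
    conv_rhs => rw [add_comm (-_), add_assoc]; enter [2, 2]; rw [this]
    abel
  rw [hs, mul_add, hc.eq] at hm
  have hu := isUnit_det_of_posDef hw
  have hci : riccatiRoot w * w⁻¹ = w⁻¹ * riccatiRoot w := by
    calc riccatiRoot w * w⁻¹ = w⁻¹ * (w * riccatiRoot w) * w⁻¹ := by
          rw [← mul_assoc, nonsing_inv_mul _ hu, one_mul]
      _ = w⁻¹ * riccatiRoot w := by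
          rw [← hc.eq, mul_assoc, mul_assoc, mul_nonsing_inv _ hu, mul_one]
  calc riccatiRoot w + riccatiRoot w * w⁻¹ * riccatiRoot w
      = w⁻¹ * (riccatiRoot w * riccatiRoot w + w * riccatiRoot w) := by
        rw [hci, mul_add, ← mul_assoc, ← mul_assoc, nonsing_inv_mul _ hu, one_mul, add_comm]
    _ = 1 := by rw [hm, nonsing_inv_mul _ hu]

end MatrixLemmas

/-! ### The matrices of the bridge -/

section BridgeMatrices

variable {d : ℕ} {σ σbar : Mat d}

lemma rMat_eq (θ : Param d) : rMat σ σbar θ = riccatiRoot (varpi σ σbar θ) := rfl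

lemma gammaMat_mul_transpose (hσ : σ.PosDef) (θ : Param d) :
    gammaMat σ σbar θ * (gammaMat σ σbar θ)ᵀ =
      CFC.sqrt σbar * (θ.τ⁻¹ * sigmaBeta σ θ.β * θ.τ⁻¹) * CFC.sqrt σbar := by
  have ht : θ.τ⁻¹ᵀ = θ.τ⁻¹ := transpose_eq_of_isHermitian θ.posDef_τ.inv.isHermitian
  have hs := sqrt_mul_self hσ
  unfold gammaMat sigmaBeta
  simp only [transpose_mul, transpose_sqrt, ht]
  calc _ = CFC.sqrt σbar * (θ.τ⁻¹ * (θ.β * (CFC.sqrt σ * CFC.sqrt σ) * θ.βᵀ) * θ.τ⁻¹) *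
        CFC.sqrt σbar := by simp only [mul_assoc]
    _ = _ := by rw [hs]

lemma posDef_sigmaBeta (hσ : σ.PosDef) {β : Mat d} (hβ : IsUnit β) : (sigmaBeta σ β).PosDef :=
  posDef_mul_mul_transpose hσ hβ

lemma posDef_gammaMat_mul_transpose (hσ : σ.PosDef) (hσbar : σbar.PosDef) (θ : Param d) :
    (gammaMat σ σbar θ * (gammaMat σ σbar θ)ᵀ).PosDef := by
  rw [gammaMat_mul_transpose hσ]
  exact posDef_mul_mul_self (posDef_mul_mul_self (posDef_sigmaBeta hσ θ.isUnit_β) θ.posDef_τ.inv)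
    (posDef_sqrt hσbar)

lemma posDef_varpi (hσ : σ.PosDef) (hσbar : σbar.PosDef) (θ : Param d) :
    (varpi σ σbar θ).PosDef :=
  (posDef_gammaMat_mul_transpose hσ hσbar θ).inv

lemma posDef_rMat (hσ : σ.PosDef) (hσbar : σbar.PosDef) (θ : Param d) :
    (rMat σ σbar θ).PosDef :=
  posDef_riccatiRoot (posDef_varpi hσ hσbar θ)

lemma posDef_varsigma (hσ : σ.PosDef) (hσbar : σbar.PosDef) (θ : Param d) :
    (varsigma σ σbar θ).PosDef :=
  posDef_mul_mul_self (posDef_rMat hσ hσbar θ) (posDef_sqrt hσbar)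

/-- The fixed point equation of `r`, conjugated by `σbar^{1/2}`. Its second summand is the
covariance transported by the bridge regression matrix. -/
lemma varsigma_fixed (hσ : σ.PosDef) (hσbar : σbar.PosDef) (θ : Param d) :
    varsigma σ σbar θ +
      varsigma σ σbar θ * (θ.τ⁻¹ * sigmaBeta σ θ.β * θ.τ⁻¹) * varsigma σ σbar θ = σbar := by
  have h := riccatiRoot_fixed (posDef_varpi hσ hσbar θ)
  rw [← rMat_eq, varpi, nonsing_inv_nonsing_inv _
    (isUnit_det_of_posDef (posDef_gammaMat_mul_transpose hσ hσbar θ)),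
    gammaMat_mul_transpose hσ] at h
  have hs := sqrt_mul_self hσbar
  unfold varsigma
  calc _ = CFC.sqrt σbar * (rMat σ σbar θ + rMat σ σbar θ *
        (CFC.sqrt σbar * (θ.τ⁻¹ * sigmaBeta σ θ.β * θ.τ⁻¹) * CFC.sqrt σbar) *
          rMat σ σbar θ) * CFC.sqrt σbar := by simp only [mul_add, add_mul, mul_assoc]
    _ = σbar := by rw [h, mul_one, hs]

lemma log_det_varsigma (hσ : σ.PosDef) (hσbar : σbar.PosDef) (θ : Param d) :
    Real.log (varsigma σ σbar θ).det =
      Real.log σbar.det + Real.log (rMat σ σbar θ).det := by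
  rw [varsigma, det_mul, det_mul, mul_comm (det _) (rMat σ σbar θ).det, mul_assoc, ← det_mul,
    sqrt_mul_self hσbar, mul_comm, Real.log_mul hσbar.det_pos.ne'
      (posDef_rMat hσ hσbar θ).det_pos.ne']

/-- The regression matrix `ς_θ τ⁻¹ β` of the bridge. -/
noncomputable def bridgeβ (σ σbar : Mat d) (θ : Param d) : Mat d :=
  varsigma σ σbar θ * θ.τ⁻¹ * θ.β

/-- The Schrödinger bridge parameter `S(θ)`. -/
noncomputable def bridge (m mbar : E d) (hσ : σ.PosDef) (hσbar : σbar.PosDef) (θ : Param d) :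
    Param d where
  α := mbar - act (bridgeβ σ σbar θ) m
  β := bridgeβ σ σbar θ
  τ := varsigma σ σbar θ
  isUnit_β := ((posDef_varsigma hσ hσbar θ).isUnit.mul θ.posDef_τ.inv.isUnit).mul θ.isUnit_β
  posDef_τ := posDef_varsigma hσ hσbar θ

lemma bridgeβ_mul_mul_transpose (hσ : σ.PosDef) (hσbar : σbar.PosDef) (θ : Param d) :
    bridgeβ σ σbar θ * σ * (bridgeβ σ σbar θ)ᵀ = varsigma σ σbar θ *
      (θ.τ⁻¹ * sigmaBeta σ θ.β * θ.τ⁻¹) * varsigma σ σbar θ := by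
  have ht : θ.τ⁻¹ᵀ = θ.τ⁻¹ := transpose_eq_of_isHermitian θ.posDef_τ.inv.isHermitian
  have hs := transpose_eq_of_isHermitian (posDef_varsigma hσ hσbar θ).isHermitian
  unfold bridgeβ sigmaBeta
  simp only [transpose_mul, ht, hs, mul_assoc]

lemma bridge_mem_admissible (m mbar : E d) (hσ : σ.PosDef) (hσbar : σbar.PosDef) (θ : Param d) :
    bridge m mbar hσ hσbar θ ∈ admissible m σ mbar σbar := by
  refine ⟨by simp [bridge], ?_⟩
  change bridgeβ σ σbar θ * σ * (bridgeβ σ σbar θ)ᵀ + varsigma σ σbar θ = σbar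
  rw [bridgeβ_mul_mul_transpose hσ hσbar, add_comm, varsigma_fixed hσ hσbar]

lemma admissible_ext {m mbar : E d} {θ₁ θ₂ : Param d} (h₁ : θ₁ ∈ admissible m σ mbar σbar)
    (h₂ : θ₂ ∈ admissible m σ mbar σbar) (h : θ₁.β = θ₂.β) : θ₁ = θ₂ := by
  obtain ⟨h1, h1'⟩ := h₁
  obtain ⟨h2, h2'⟩ := h₂
  ext1
  · rw [← h2, h] at h1
    exact add_right_cancel h1
  · exact h
  · rw [← h2', h] at h1'
    exact add_left_cancel h1'

/-- The relative entropy of `P_{θ₁}` with respect to `P_θ`, in closed form. -/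
noncomputable def gaussianEnt (m : E d) (σ : Mat d) (θ₁ θ : Param d) : ℝ :=
  1 / 2 * ((θ.τ⁻¹ * θ₁.τ).trace - d - Real.log θ₁.τ.det + Real.log θ.τ.det +
    (θ.τ⁻¹ * ((θ₁.β - θ.β) * σ * (θ₁.β - θ.β)ᵀ)).trace +
    (θ₁.α + act θ₁.β m - (θ.α + act θ.β m)).ofLp ⬝ᵥ
      θ.τ⁻¹ *ᵥ (θ₁.α + act θ₁.β m - (θ.α + act θ.β m)).ofLp)

/-- The terms `τ₁` and `β₁ σ β₁'` add up to `σbar`, so only `log det τ₁` and a cross term linear in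
`β₁` still depend on `θ₁`. -/
lemma gaussianEnt_of_admissible {m mbar : E d} (hσ : σ.PosDef) {θ₁ : Param d}
    (h₁ : θ₁ ∈ admissible m σ mbar σbar) (θ : Param d) :
    gaussianEnt m σ θ₁ θ = 1 / 2 * ((θ.τ⁻¹ * σbar).trace + (θ.τ⁻¹ * sigmaBeta σ θ.β).trace - d
      - Real.log θ₁.τ.det + Real.log θ.τ.det - 2 * (θ.τ⁻¹ * (θ.β * σ * θ₁.βᵀ)).trace
      + (mbar - (θ.α + act θ.β m)).ofLp ⬝ᵥ θ.τ⁻¹ *ᵥ (mbar - (θ.α + act θ.β m)).ofLp) := by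
  obtain ⟨h1, h2⟩ := h₁
  have ht : θ.τ⁻¹ᵀ = θ.τ⁻¹ := transpose_eq_of_isHermitian θ.posDef_τ.inv.isHermitian
  have hs : σᵀ = σ := transpose_eq_of_isHermitian hσ.isHermitian
  have h3 : (θ.τ⁻¹ * (θ₁.β * σ * θ.βᵀ)).trace = (θ.τ⁻¹ * (θ.β * σ * θ₁.βᵀ)).trace := by
    rw [← trace_transpose]
    simp only [transpose_mul, transpose_transpose, ht, hs]
    rw [trace_mul_comm, mul_assoc]
  unfold gaussianEnt
  rw [h1, ← h2]
  simp only [transpose_sub, sub_mul, mul_sub, mul_add, trace_add, trace_sub, h3, sigmaBeta]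
  ring

/-- The entropy excess over the bridge controls the distance to the bridge. -/
lemma gaussianEnt_bridge_add_le {m mbar : E d} (hσ : σ.PosDef) (hσbar : σbar.PosDef)
    {θ₁ : Param d} (h₁ : θ₁ ∈ admissible m σ mbar σbar) (θ : Param d) :
    gaussianEnt m σ (bridge m mbar hσ hσbar θ) θ + 1 / 2 *
      ((θ₁.β - bridgeβ σ σbar θ) * σ * (θ₁.β - bridgeβ σ σbar θ)ᵀ *
        (varsigma σ σbar θ)⁻¹).trace ≤ gaussianEnt m σ θ₁ θ := by
  rw [gaussianEnt_of_admissible hσ h₁,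
    gaussianEnt_of_admissible hσ (bridge_mem_admissible m mbar hσ hσbar θ)]
  change 1 / 2 * ((θ.τ⁻¹ * σbar).trace + (θ.τ⁻¹ * sigmaBeta σ θ.β).trace - d
    - Real.log (varsigma σ σbar θ).det + Real.log θ.τ.det
      - 2 * (θ.τ⁻¹ * (θ.β * σ * (bridgeβ σ σbar θ)ᵀ)).trace + _) + _ ≤ _
  have hv := posDef_varsigma hσ hσbar θ
  have hl := log_det_sub_log_det_le θ₁.posDef_τ hv
  have h2 := eq_sub_of_add_eq' h₁.2
  have hb := eq_sub_of_add_eq (bridge_mem_admissible m mbar hσ hσbar θ).2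
  change bridgeβ σ σbar θ * σ * (bridgeβ σ σbar θ)ᵀ = σbar - varsigma σ σbar θ at hb
  have hs : σᵀ = σ := transpose_eq_of_isHermitian hσ.isHermitian
  have hvt := transpose_eq_of_isHermitian hv.inv.isHermitian
  have hu := isUnit_det_of_posDef hv
  -- Since `τ⁻¹ β = ς⁻¹ B` for the bridge matrix `B`, the linear term becomes the cross term of a
  -- square centered at `B` and weighted by `ς⁻¹`.
  have key (C : Mat d) : (θ.τ⁻¹ * (θ.β * σ * C)).trace =
      ((varsigma σ σbar θ)⁻¹ * (bridgeβ σ σbar θ * σ * C)).trace := by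
    simp only [bridgeβ, mul_assoc]
    rw [nonsing_inv_mul_cancel_left _ _ hu]
  have hsymm : ((varsigma σ σbar θ)⁻¹ * (θ₁.β * σ * (bridgeβ σ σbar θ)ᵀ)).trace =
      ((varsigma σ σbar θ)⁻¹ * (bridgeβ σ σbar θ * σ * θ₁.βᵀ)).trace := by
    rw [← trace_transpose]
    simp only [transpose_mul, transpose_transpose, hvt, hs]
    rw [trace_mul_comm, mul_assoc]
  rw [key, key, trace_mul_comm _ (varsigma σ σbar θ)⁻¹]
  simp only [transpose_sub, sub_mul, mul_sub, trace_sub, hsymm, hb]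
  rw [nonsing_inv_mul _ hu, trace_one]
  have h3 : ((varsigma σ σbar θ)⁻¹ * θ₁.τ).trace = ((varsigma σ σbar θ)⁻¹ * σbar).trace -
      ((varsigma σ σbar θ)⁻¹ * (θ₁.β * σ * θ₁.βᵀ)).trace := by
    rw [h2, mul_sub, trace_sub]
  simp only [Fintype.card_fin] at hl ⊢
  linarith

end BridgeMatrices

/-! ### The small noise expansion of the bridge matrices -/

section Riccati

variable {n : Type*} [Fintype n] [DecidableEq n] {Y Z : Matrix n n ℝ} {t : ℝ}

/-- Sylvester equation: `(Z - Y) Z + Y (Z - Y) = Z² - Y² = t Y`. No commutation of `Y` and `Z` is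
used. -/
lemma posSemidef_sub_of_sq_eq (hY : Y.PosDef) (hZ : Z.PosDef) (ht : 0 < t)
    (h : t • Y + Y * Y = Z * Z) : (Z - Y).PosSemidef := by
  refine posSemidef_of_mul_add_mul (P := Z) (Q := Y) (hZ.isHermitian.sub hY.isHermitian)
    (hZ.add hY) ?_
  have : (Z - Y) * Z + Y * (Z - Y) = t • Y := by
    rw [sub_mul, mul_sub, ← h]; abel
  rw [this]
  exact hY.posSemidef.smul ht.le

/-- Here `t I - (Z - Y)` solves the same Sylvester equation with right-hand side `t Z`. -/
lemma posSemidef_smul_one_sub_of_sq_eq (hY : Y.PosDef) (hZ : Z.PosDef) (ht : 0 < t)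
    (h : t • Y + Y * Y = Z * Z) : (t • (1 : Matrix n n ℝ) - (Z - Y)).PosSemidef := by
  refine posSemidef_of_mul_add_mul (P := Z) (Q := Y)
    ((PosDef.one.smul ht).isHermitian.sub (hZ.isHermitian.sub hY.isHermitian)) (hZ.add hY) ?_
  have : (t • (1 : Matrix n n ℝ) - (Z - Y)) * Z + Y * (t • 1 - (Z - Y)) = t • Z := by
    simp only [sub_mul, mul_sub, smul_mul_assoc, mul_smul_comm, one_mul, mul_one, ← h]; abel
  rw [this]
  exact hZ.posSemidef.smul ht.le

lemma abs_trace_sub_le_of_sq_eq (hY : Y.PosDef) (hZ : Z.PosDef) (ht : 0 < t)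
    (h : t • Y + Y * Y = Z * Z) : |(Z - Y).trace| ≤ t * Fintype.card n := by
  have h1 := (posSemidef_sub_of_sq_eq hY hZ ht h).trace_nonneg
  have h2 := (posSemidef_smul_one_sub_of_sq_eq hY hZ ht h).trace_nonneg
  rw [trace_sub, trace_smul, trace_one, smul_eq_mul] at h2
  rw [abs_of_nonneg h1]
  linarith

lemma log_det_le_of_sq_eq (hY : Y.PosDef) (hZ : Z.PosDef) (ht : 0 < t)
    (h : t • Y + Y * Y = Z * Z) : Real.log Y.det ≤ Z.trace := by
  have h1 := (posSemidef_sub_of_sq_eq hY hZ ht h).trace_nonneg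
  have h2 := log_det_le_trace_sub_card hY
  rw [trace_sub] at h1
  have : (0 : ℝ) ≤ Fintype.card n := by positivity
  linarith

/-- Multiplying the equation by `Y⁻¹` gives `Y⁻¹ = Z⁻² (Y + t I)`. With `Y ≤ Z` and `t ≤ 1` its
trace is bounded uniformly in `t`, and it dominates `log det Y⁻¹`. -/
lemma neg_log_det_le_of_sq_eq (hY : Y.PosDef) (hZ : Z.PosDef) (ht : 0 < t) (ht1 : t ≤ 1)
    (h : t • Y + Y * Y = Z * Z) :
    -Real.log Y.det ≤ ((Z * Z)⁻¹ * Z).trace + ((Z * Z)⁻¹).trace := by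
  have hM : (Z * Z).PosDef := by simpa using posDef_mul_mul_self PosDef.one hZ
  have h1 := trace_mul_nonneg hM.inv.posSemidef (posSemidef_sub_of_sq_eq hY hZ ht h)
  have h2 := log_det_le_trace_sub_card hY.inv
  have hinv : Y⁻¹ = (Z * Z)⁻¹ * Y + t • (Z * Z)⁻¹ := by
    have h3 : (Z * Z) * Y⁻¹ = Y + t • 1 := by
      rw [← h, add_mul, smul_mul_assoc, mul_nonsing_inv_cancel_right _ _ (isUnit_det_of_posDef hY),
        mul_nonsing_inv _ (isUnit_det_of_posDef hY), add_comm]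
    rw [← nonsing_inv_mul_cancel_left (A := Z * Z) Y⁻¹ (isUnit_det_of_posDef hM), h3, mul_add,
      mul_smul_comm, mul_one]
  have h4 : Y⁻¹.trace = ((Z * Z)⁻¹ * Y).trace + t * ((Z * Z)⁻¹).trace := by
    conv_lhs => rw [hinv]
    rw [trace_add, trace_smul, smul_eq_mul]
  rw [det_nonsing_inv, Ring.inverse_eq_inv', Real.log_inv] at h2
  rw [mul_sub, trace_sub] at h1
  have h5 : t * ((Z * Z)⁻¹).trace ≤ ((Z * Z)⁻¹).trace :=
    mul_le_of_le_one_left hM.inv.posSemidef.trace_nonneg ht1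
  have : (0 : ℝ) ≤ Fintype.card n := by positivity
  linarith

end Riccati

/-! ### The geometric mean as the optimal transport matrix. -/

section GeometricMean

variable {d : ℕ} {u v : Mat d}

/-- The root `(v^{1/2} u v^{1/2})^{1/2}`. -/
noncomputable def crossRoot (u v : Mat d) : Mat d := CFC.sqrt (CFC.sqrt v * u * CFC.sqrt v)

lemma posDef_crossRoot (hu : u.PosDef) (hv : v.PosDef) : (crossRoot u v).PosDef :=
  posDef_sqrt (posDef_mul_mul_self hu (posDef_sqrt hv))

lemma crossRoot_mul_self (hu : u.PosDef) (hv : v.PosDef) :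
    crossRoot u v * crossRoot u v = CFC.sqrt v * u * CFC.sqrt v :=
  sqrt_mul_self (posDef_mul_mul_self hu (posDef_sqrt hv))

lemma geomMean_inv_eq (hv : v.PosDef) :
    geomMean u v⁻¹ = (CFC.sqrt v)⁻¹ * crossRoot u v * (CFC.sqrt v)⁻¹ := by
  unfold geomMean crossRoot
  rw [← hv.posSemidef.inv_sqrt, nonsing_inv_nonsing_inv _ (isUnit_det_of_posDef (posDef_sqrt hv))]

lemma posDef_geomMean_inv (hu : u.PosDef) (hv : v.PosDef) : (geomMean u v⁻¹).PosDef := by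
  rw [geomMean_inv_eq hv]
  exact posDef_mul_mul_self (posDef_crossRoot hu hv) (posDef_sqrt hv).inv

/-- The geometric mean `u ♯ v⁻¹` transports `v` to `u`. -/
lemma geomMean_inv_mul_mul (hu : u.PosDef) (hv : v.PosDef) :
    geomMean u v⁻¹ * v * geomMean u v⁻¹ = u := by
  have hp := isUnit_det_of_posDef (posDef_sqrt hv)
  have hs := sqrt_mul_self hv
  rw [geomMean_inv_eq hv]
  calc _ = (CFC.sqrt v)⁻¹ * crossRoot u v * (CFC.sqrt v)⁻¹ * (CFC.sqrt v * CFC.sqrt v) *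
        ((CFC.sqrt v)⁻¹ * crossRoot u v * (CFC.sqrt v)⁻¹) := by rw [hs]
    _ = (CFC.sqrt v)⁻¹ * (crossRoot u v * ((CFC.sqrt v)⁻¹ * CFC.sqrt v) *
        (CFC.sqrt v * (CFC.sqrt v)⁻¹) * crossRoot u v) * (CFC.sqrt v)⁻¹ := by
        simp only [mul_assoc]
    _ = (CFC.sqrt v)⁻¹ * (CFC.sqrt v * u * CFC.sqrt v) * (CFC.sqrt v)⁻¹ := by
        rw [nonsing_inv_mul _ hp, mul_nonsing_inv _ hp, mul_one, mul_one, crossRoot_mul_self hu hv]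
    _ = ((CFC.sqrt v)⁻¹ * CFC.sqrt v) * u * (CFC.sqrt v * (CFC.sqrt v)⁻¹) := by
        simp only [mul_assoc]
    _ = u := by rw [nonsing_inv_mul _ hp, mul_nonsing_inv _ hp, mul_one, one_mul]

/-- Identifies the cross term of the Wasserstein distance with `Tr Z`, so that it can be compared
with `Tr Y`. -/
lemma trace_geomMean_inv_mul (hv : v.PosDef) :
    (geomMean u v⁻¹ * v).trace = (crossRoot u v).trace := by
  have hp := isUnit_det_of_posDef (posDef_sqrt hv)
  rw [geomMean_inv_eq hv]
  calc _ = ((CFC.sqrt v)⁻¹ * crossRoot u v * ((CFC.sqrt v)⁻¹ *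
        (CFC.sqrt v * CFC.sqrt v))).trace := by rw [sqrt_mul_self hv, mul_assoc]
    _ = _ := by
      rw [nonsing_inv_mul_cancel_left _ _ hp, mul_assoc, trace_mul_comm,
        mul_nonsing_inv_cancel_right _ _ hp]

end GeometricMean

/-! ### The `O(t)` bound on the closed form. -/

section Rate

variable {d : ℕ} {σ σbar : Mat d}

lemma refParam_inv {α : E d} {β : Mat d} (hβ : IsUnit β) {t : ℝ} (ht : 0 < t) :
    (refParam α β hβ t ht).τ⁻¹ = t⁻¹ • (1 : Mat d) := by
  refine Matrix.inv_eq_right_inv ?_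
  simp [refParam, smul_smul, ht.ne']

/-- The bridge covariance seen in the coordinates where `σ_β` is the identity. -/
noncomputable def normalizedVarsigma (σ σbar : Mat d) (α : E d) {β : Mat d} (hβ : IsUnit β)
    {t : ℝ} (ht : 0 < t) : Mat d :=
  CFC.sqrt (sigmaBeta σ β) * (t⁻¹ • varsigma σ σbar (refParam α β hβ t ht)) *
    CFC.sqrt (sigmaBeta σ β)

lemma posDef_normalizedVarsigma (hσ : σ.PosDef) (hσbar : σbar.PosDef) (α : E d) {β : Mat d}
    (hβ : IsUnit β) {t : ℝ} (ht : 0 < t) : (normalizedVarsigma σ σbar α hβ ht).PosDef :=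
  posDef_mul_mul_self ((posDef_varsigma hσ hσbar _).smul (inv_pos.2 ht))
    (posDef_sqrt (posDef_sigmaBeta hσ hβ))

/-- For `τ = t I` the Riccati equation is `ς + t⁻² ς σ_β ς = σbar`; conjugate it by `σ_β^{1/2}`. -/
lemma normalizedVarsigma_sq (hσ : σ.PosDef) (hσbar : σbar.PosDef) (α : E d) {β : Mat d}
    (hβ : IsUnit β) {t : ℝ} (ht : 0 < t) :
    t • normalizedVarsigma σ σbar α hβ ht +
      normalizedVarsigma σ σbar α hβ ht * normalizedVarsigma σ σbar α hβ ht =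
      crossRoot σbar (sigmaBeta σ β) * crossRoot σbar (sigmaBeta σ β) := by
  have hs := posDef_sigmaBeta hσ hβ
  have hf := varsigma_fixed hσ hσbar (refParam α β hβ t ht)
  rw [refParam_inv] at hf
  change _ + _ * ((t⁻¹ • (1 : Mat d)) * sigmaBeta σ β * (t⁻¹ • (1 : Mat d))) * _ = _ at hf
  rw [crossRoot_mul_self hσbar hs]
  unfold normalizedVarsigma
  set p := CFC.sqrt (sigmaBeta σ β)
  set V := varsigma σ σbar (refParam α β hβ t ht)
  have hp : p * p = sigmaBeta σ β := sqrt_mul_self hs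
  rw [← hp] at hf
  conv_rhs => rw [← hf]
  simp only [mul_add, add_mul, smul_mul_assoc, mul_smul_comm, one_mul, mul_one,
    smul_smul, mul_inv_cancel₀ ht.ne', one_smul, mul_assoc]

lemma trace_normalizedVarsigma (hσ : σ.PosDef) (α : E d) {β : Mat d}
    (hβ : IsUnit β) {t : ℝ} (ht : 0 < t) :
    (normalizedVarsigma σ σbar α hβ ht).trace =
      ((t⁻¹ • varsigma σ σbar (refParam α β hβ t ht)) * sigmaBeta σ β).trace := by
  unfold normalizedVarsigma
  rw [mul_assoc, trace_mul_comm, mul_assoc, sqrt_mul_self (posDef_sigmaBeta hσ hβ)]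

lemma log_det_normalizedVarsigma (hσ : σ.PosDef) (hσbar : σbar.PosDef) (α : E d) {β : Mat d}
    (hβ : IsUnit β) {t : ℝ} (ht : 0 < t) :
    Real.log (normalizedVarsigma σ σbar α hβ ht).det =
      Real.log (t⁻¹ • rMat σ σbar (refParam α β hβ t ht)).det + Real.log σbar.det +
        Real.log (sigmaBeta σ β).det := by
  have hs := posDef_sigmaBeta hσ hβ
  have hr := posDef_rMat hσ hσbar (refParam α β hβ t ht)
  have h : (normalizedVarsigma σ σbar α hβ ht).det =
      (t⁻¹ • rMat σ σbar (refParam α β hβ t ht)).det * σbar.det * (sigmaBeta σ β).det := by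
    have h1 : (sigmaBeta σ β).det = (CFC.sqrt (sigmaBeta σ β)).det ^ 2 := by
      rw [sq, ← det_mul, sqrt_mul_self hs]
    have h2 : σbar.det = (CFC.sqrt σbar).det ^ 2 := by
      rw [sq, ← det_mul, sqrt_mul_self hσbar]
    rw [h1, h2]
    simp only [normalizedVarsigma, varsigma, det_mul, det_smul]
    ring
  rw [h, Real.log_mul (mul_pos (hr.smul (inv_pos.2 ht)).det_pos hσbar.det_pos).ne' hs.det_pos.ne',
    Real.log_mul (hr.smul (inv_pos.2 ht)).det_pos.ne' hσbar.det_pos.ne']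

/-- The right hand side of the small noise expansion is of order `t`. -/
lemma exists_rate (hσ : σ.PosDef) (hσbar : σbar.PosDef) (α : E d) {β : Mat d} (hβ : IsUnit β) :
    ∃ c : ℝ, ∀ (t : ℝ) (ht : 0 < t), t ≤ 1 →
      |((geomMean σbar (sigmaBeta σ β)⁻¹ -
          t⁻¹ • varsigma σ σbar (refParam α β hβ t ht)) * sigmaBeta σ β).trace +
        t / 2 * (d * Real.log (2 * Real.pi) -
          Real.log (t⁻¹ • rMat σ σbar (refParam α β hβ t ht)).det)| ≤ c * t := by
  have hs := posDef_sigmaBeta hσ hβ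
  set Z := crossRoot σbar (sigmaBeta σ β)
  have hZ : Z.PosDef := posDef_crossRoot hσbar hs
  set L := |(d * Real.log (2 * Real.pi) + Real.log σbar.det + Real.log (sigmaBeta σ β).det)|
  set K := |Z.trace| + |((Z * Z)⁻¹ * Z).trace| + |((Z * Z)⁻¹).trace|
  -- `d` comes from `0 ≤ Z - Y ≤ t I`, `L` from the `t`-independent log-determinants, and `K` bounds
  -- `|log det Y|` for `t ≤ 1`.
  refine ⟨d + 1 / 2 * (L + K), fun t ht ht1 ↦ ?_⟩
  have hY := posDef_normalizedVarsigma hσ hσbar α hβ ht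
  have hYZ := normalizedVarsigma_sq hσ hσbar α hβ ht
  have h1 := abs_trace_sub_le_of_sq_eq hY hZ ht hYZ
  have h2 := log_det_le_of_sq_eq hY hZ ht hYZ
  have h3 := neg_log_det_le_of_sq_eq hY hZ ht ht1 hYZ
  rw [sub_mul, trace_sub, trace_geomMean_inv_mul hs, ← trace_normalizedVarsigma hσ, ← trace_sub]
  have h4 := log_det_normalizedVarsigma hσ hσbar α hβ ht
  rw [Fintype.card_fin] at h1
  set W := Real.log (normalizedVarsigma σ σbar α hβ ht).det
  have h5 : |W| ≤ K := abs_le.2 ⟨by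
    linarith [le_abs_self ((Z * Z)⁻¹ * Z).trace, le_abs_self ((Z * Z)⁻¹).trace,
      abs_nonneg Z.trace], by
    linarith [le_abs_self Z.trace, abs_nonneg ((Z * Z)⁻¹ * Z).trace,
      abs_nonneg ((Z * Z)⁻¹).trace]⟩
  have h6 : |d * Real.log (2 * Real.pi) -
      Real.log (t⁻¹ • rMat σ σbar (refParam α β hβ t ht)).det| ≤ L + K := by
    have : d * Real.log (2 * Real.pi) -
        Real.log (t⁻¹ • rMat σ σbar (refParam α β hβ t ht)).det =
        (d * Real.log (2 * Real.pi) + Real.log σbar.det + Real.log (sigmaBeta σ β).det) - W := by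
      rw [h4]; ring
    rw [this]
    exact (abs_sub _ _).trans (add_le_add_right h5 _)
  refine (abs_add_le _ _).trans ?_
  rw [abs_mul, abs_of_pos (by positivity : (0 : ℝ) < t / 2)]
  have h7 := mul_le_mul_of_nonneg_left h6 (by positivity : (0 : ℝ) ≤ t / 2)
  calc _ ≤ t * d + t / 2 * (L + K) := add_le_add h1 h7
    _ = _ := by ring

end Rate

/-! ### Multivariate Gaussian laws -/

section Gaussian

variable {d : ℕ}

lemma ofLp_act (B : Mat d) (x : E d) : (act B x).ofLp = B *ᵥ x.ofLp := rfl

@[fun_prop]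
lemma continuous_act (B : Mat d) : Continuous (act B) := by
  unfold act; fun_prop

lemma inner_act (B : Mat d) (x y : E d) : inner ℝ (act B x) y = inner ℝ x (act Bᵀ y) := by
  simp only [EuclideanSpace.inner_eq_star_dotProduct, ofLp_act, star_trivial]
  rw [mulVec_transpose, dotProduct_mulVec]

/-- Affine images of Gaussian laws are Gaussian. -/
lemma map_add_act_multivariateGaussian {σ : Mat d} (hσ : σ.PosSemidef) (m c : E d) (B : Mat d) :
    (multivariateGaussian m σ).map (fun x ↦ c + act B x) =
      multivariateGaussian (c + act B m) (B * σ * Bᵀ) := by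
  have hf : Measurable (fun x ↦ c + act B x) := by fun_prop
  have := Measure.isProbabilityMeasure_map (μ := multivariateGaussian m σ) hf.aemeasurable
  refine Measure.ext_of_charFun ?_
  ext t
  rw [charFun_multivariateGaussian (posSemidef_mul_mul_transpose hσ B), charFun_apply,
    integral_map hf.aemeasurable (by fun_prop)]
  have h (x : E d) : Complex.exp ((inner ℝ (c + act B x) t : ℝ) * Complex.I) =
      Complex.exp ((inner ℝ c t : ℝ) * Complex.I) *
        Complex.exp ((inner ℝ x (act Bᵀ t) : ℝ) * Complex.I) := by
    rw [← Complex.exp_add, inner_add_left, inner_act]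
    push_cast
    ring_nf
  simp_rw [h]
  rw [integral_const_mul, ← charFun_apply, charFun_multivariateGaussian hσ, ← Complex.exp_add]
  congr 1
  have h1 : (inner ℝ t (c + act B m) : ℝ) = inner ℝ c t + inner ℝ (act Bᵀ t) m := by
    rw [inner_add_right, real_inner_comm, inner_act Bᵀ, transpose_transpose]
  have h2 : (act Bᵀ t).ofLp ⬝ᵥ σ *ᵥ (act Bᵀ t).ofLp = t.ofLp ⬝ᵥ (B * σ * Bᵀ) *ᵥ t.ofLp := by
    rw [ofLp_act, ← mulVec_mulVec, ← mulVec_mulVec, dotProduct_mulVec t.ofLp B,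
      ← mulVec_transpose]
  rw [h1, ← h2]
  push_cast
  ring

lemma kernel_apply (θ : Param d) (x : E d) :
    kernel θ x = multivariateGaussian (θ.α + act θ.β x) θ.τ := rfl

/-- The image of a Gaussian law under a linear Gaussian transition is Gaussian. -/
lemma kernel_comp_multivariateGaussian {σ : Mat d} (hσ : σ.PosSemidef) (m : E d) (θ : Param d) :
    kernel θ ∘ₘ multivariateGaussian m σ =
      multivariateGaussian (θ.α + act θ.β m) (θ.β * σ * θ.βᵀ + θ.τ) := by
  refine Measure.ext_of_charFun ?_
  ext t
  rw [charFun_multivariateGaussian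
    ((posSemidef_mul_mul_transpose hσ θ.β).add θ.posDef_τ.posSemidef), charFun_apply,
    ← Measure.snd_compProd, Measure.snd, integral_map (by fun_prop) (by fun_prop),
    Measure.integral_compProd]
  -- The noise contributes a factor independent of `x`; what remains is the characteristic function
  -- of an affine image of `ν_{m,σ}`.
  · have h (x : E d) : ∫ y, Complex.exp ((inner ℝ y t : ℝ) * Complex.I) ∂(kernel θ x) =
        Complex.exp (-(t.ofLp ⬝ᵥ θ.τ *ᵥ t.ofLp : ℝ) / 2) *
          Complex.exp ((inner ℝ (θ.α + act θ.β x) t : ℝ) * Complex.I) := by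
      rw [kernel_apply, ← charFun_apply, charFun_multivariateGaussian θ.posDef_τ.posSemidef,
        ← Complex.exp_add, real_inner_comm]
      ring_nf
    simp_rw [h]
    have hf : Measurable (fun x ↦ θ.α + act θ.β x) := by fun_prop
    rw [integral_const_mul, ← integral_map (μ := multivariateGaussian m σ) hf.aemeasurable
      (f := fun y ↦ Complex.exp ((inner ℝ y t : ℝ) * Complex.I)) (by fun_prop), ← charFun_apply,
      map_add_act_multivariateGaussian hσ,
      charFun_multivariateGaussian (posSemidef_mul_mul_transpose hσ θ.β), ← Complex.exp_add,
      add_mulVec, dotProduct_add]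
    push_cast
    ring_nf
  · refine (integrable_const (1 : ℝ)).mono' (by fun_prop) (ae_of_all _ fun z ↦ ?_)
    rw [Complex.norm_exp_ofReal_mul_I]

lemma memLp_coord_multivariateGaussian (m : E d) (σ : Mat d) (i : Fin d) :
    MemLp (fun x : E d ↦ x.ofLp i) 2 (multivariateGaussian m σ) := by
  have h := (IsGaussian.memLp_two_id (μ := multivariateGaussian m σ)).continuousLinearMap_comp
    (EuclideanSpace.proj (𝕜 := ℝ) i)
  exact h

lemma integral_coord_multivariateGaussian (m : E d) (σ : Mat d) (i : Fin d) :
    ∫ x, x.ofLp i ∂(multivariateGaussian m σ) = m.ofLp i := by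
  have h := (EuclideanSpace.proj (𝕜 := ℝ) i).integral_comp_comm
    (IsGaussian.integrable_id (μ := multivariateGaussian m σ))
  simpa using h

/-- The quadratic form of `A` centered at `c`. -/
noncomputable def quad (A : Mat d) (c x : E d) : ℝ := (x - c).ofLp ⬝ᵥ A *ᵥ (x - c).ofLp

@[fun_prop]
lemma continuous_quad (A : Mat d) (c : E d) : Continuous (quad A c) := by
  unfold quad
  simp only [dotProduct, mulVec]
  fun_prop

lemma quad_eq_sum (A : Mat d) (c x : E d) :
    quad A c x = ∑ i, ∑ j, A i j * ((x.ofLp i - c.ofLp i) * (x.ofLp j - c.ofLp j)) := by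
  simp only [quad, dotProduct, mulVec, Finset.mul_sum, WithLp.ofLp_sub, Pi.sub_apply]
  refine Finset.sum_congr rfl fun i _ ↦ Finset.sum_congr rfl fun j _ ↦ ?_
  ring

lemma integrable_quad (A : Mat d) (c m : E d) (σ : Mat d) :
    Integrable (quad A c) (multivariateGaussian m σ) := by
  simp_rw [funext (quad_eq_sum A c)]
  refine integrable_finsetSum _ fun i _ ↦ integrable_finsetSum _ fun j _ ↦ ?_
  refine Integrable.const_mul ?_ _
  exact ((memLp_coord_multivariateGaussian m σ i).sub (memLp_const _)).integrable_mul
    ((memLp_coord_multivariateGaussian m σ j).sub (memLp_const _))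

lemma integral_quad {σ : Mat d} (hσ : σ.PosSemidef) (A : Mat d) (c m : E d) :
    ∫ x, quad A c x ∂(multivariateGaussian m σ) = (A * σ).trace + quad A c m := by
  have hi (i : Fin d) := memLp_coord_multivariateGaussian m σ i
  have hm (i j : Fin d) : ∫ x, (x.ofLp i - c.ofLp i) * (x.ofLp j - c.ofLp j)
      ∂(multivariateGaussian m σ) =
      σ i j + (m.ofLp i - c.ofLp i) * (m.ofLp j - c.ofLp j) := by
    have h1 := covariance_eq_sub ((hi i).sub (memLp_const (c.ofLp i)))
      ((hi j).sub (memLp_const (c.ofLp j)))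
    have h2 : cov[(fun x : E d ↦ x.ofLp i) - fun _ ↦ c.ofLp i,
        (fun x : E d ↦ x.ofLp j) - fun _ ↦ c.ofLp j; multivariateGaussian m σ] = σ i j := by
      rw [← covariance_eval_multivariateGaussian (μ := m) hσ i j]
      simp only [Pi.sub_def]
      rw [covariance_sub_const_left ((hi i).integrable (by norm_num)),
        covariance_sub_const_right ((hi j).integrable (by norm_num))]
    have h3 (i : Fin d) : ∫ x : E d, (x.ofLp i - c.ofLp i) ∂(multivariateGaussian m σ) =
        m.ofLp i - c.ofLp i := by
      rw [integral_sub ((hi i).integrable (by norm_num)) (integrable_const _),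
        integral_coord_multivariateGaussian]
      simp
    rw [h2] at h1
    simp only [Pi.mul_apply, Pi.sub_apply, h3] at h1
    linarith
  simp_rw [quad_eq_sum]
  have hint (i j : Fin d) : Integrable (fun x : E d ↦ A i j *
      ((x.ofLp i - c.ofLp i) * (x.ofLp j - c.ofLp j))) (multivariateGaussian m σ) :=
    (((hi i).sub (memLp_const _)).integrable_mul ((hi j).sub (memLp_const _))).const_mul _
  rw [integral_finsetSum _ fun i _ ↦ integrable_finsetSum _ fun j _ ↦ hint i j]
  simp_rw [fun i ↦ integral_finsetSum Finset.univ fun j _ ↦ hint i j, integral_const_mul, hm,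
    mul_add, Finset.sum_add_distrib]
  congr 1
  simp only [trace, diag, mul_apply]
  refine Finset.sum_congr rfl fun i _ ↦ Finset.sum_congr rfl fun j _ ↦ ?_
  rw [show σ i j = σ j i by
    conv_lhs => rw [← transpose_eq_of_isHermitian hσ.isHermitian]
    rfl]

end Gaussian

/-! ### Densities and relative entropies of Gaussian laws -/

section Density

variable {d : ℕ}

/-- The logarithm of the density of the Gaussian law `ν_{μ,τ}`. -/
noncomputable def logDensity (μ : E d) (τ : Mat d) (y : E d) : ℝ :=
  -(1 / 2) * (d * Real.log (2 * Real.pi) + Real.log τ.det + quad τ⁻¹ μ y)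

@[fun_prop]
lemma continuous_logDensity (μ : E d) (τ : Mat d) : Continuous (logDensity μ τ) := by
  unfold logDensity; fun_prop

lemma logDensity_zero_one (x : E d) :
    logDensity 0 1 x = -(d / 2 * Real.log (2 * Real.pi)) + -(1 / 2) * ‖x‖ ^ 2 := by
  simp only [logDensity, quad, inv_one, sub_zero, one_mulVec, det_one, Real.log_one,
    EuclideanSpace.real_norm_sq_eq, dotProduct, ← sq]
  ring

lemma ofReal_exp_logDensity_zero_one (x : E d) :
    ((Real.exp (logDensity 0 1 x) : ℝ) : ℂ) =
      Complex.exp (-(d / 2 * Real.log (2 * Real.pi)) : ℝ) *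
        Complex.exp (-(1 / 2 : ℂ) * ‖x‖ ^ 2) := by
  rw [logDensity_zero_one, Real.exp_add]
  push_cast
  rfl

lemma integrable_exp_logDensity_zero_one :
    Integrable (fun x : E d ↦ Real.exp (logDensity 0 1 x)) := by
  have h := (GaussianFourier.integrable_cexp_neg_mul_sq_norm_add (V := E d)
    (b := (1 / 2 : ℂ)) (by norm_num) 0 0).const_mul
      (Complex.exp (-(d / 2 * Real.log (2 * Real.pi)) : ℝ))
  have h2 : Integrable (fun x : E d ↦ ((Real.exp (logDensity 0 1 x) : ℝ) : ℂ)) := by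
    simpa only [ofReal_exp_logDensity_zero_one, zero_mul, add_zero] using h
  exact h2.re

/-- Both sides are finite measures with the same characteristic function, by the Fourier transform
of `exp (-‖x‖²/2)`. -/
lemma stdGaussian_eq_withDensity :
    stdGaussian (E d) =
      volume.withDensity fun x ↦ ENNReal.ofReal (Real.exp (logDensity 0 1 x)) := by
  have : IsFiniteMeasure ((volume : Measure (E d)).withDensity
      fun x ↦ ENNReal.ofReal (Real.exp (logDensity 0 1 x))) :=
    isFiniteMeasure_withDensity_ofReal integrable_exp_logDensity_zero_one.2
  refine Measure.ext_of_charFun ?_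
  ext t
  rw [charFun_stdGaussian, charFun_apply, integral_withDensity_eq_integral_toReal_smul
    (by fun_prop) (ae_of_all _ fun _ ↦ ENNReal.ofReal_lt_top)]
  have h (x : E d) : (ENNReal.ofReal (Real.exp (logDensity 0 1 x))).toReal •
      Complex.exp ((inner ℝ x t : ℝ) * Complex.I) =
      Complex.exp (-(d / 2 * Real.log (2 * Real.pi)) : ℝ) *
        Complex.exp (-(1 / 2 : ℂ) * ‖x‖ ^ 2 + Complex.I * (inner ℝ t x : ℝ)) := by
    rw [ENNReal.toReal_ofReal (Real.exp_nonneg _), Complex.real_smul,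
      ofReal_exp_logDensity_zero_one, real_inner_comm, Complex.exp_add, mul_assoc, mul_comm
      Complex.I]
  simp_rw [h]
  rw [integral_const_mul, GaussianFourier.integral_cexp_neg_mul_sq_norm_add (by norm_num)]
  have h2 : ((Real.pi : ℂ) / (1 / 2 : ℂ)) ^ ((Module.finrank ℝ (E d) : ℂ) / 2) =
      Complex.exp ((d / 2 * Real.log (2 * Real.pi) : ℝ)) := by
    have hpi : ((Real.pi : ℂ) / (1 / 2 : ℂ)) = ((2 * Real.pi : ℝ) : ℂ) := by
      push_cast; ring
    rw [hpi, Complex.cpow_def_of_ne_zero (by exact_mod_cast Real.two_pi_pos.ne'),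
      ← Complex.ofReal_log Real.two_pi_pos.le, finrank_euclideanSpace_fin]
    push_cast
    ring_nf
  rw [h2, ← mul_assoc, ← Complex.exp_add, ← Complex.exp_add, Complex.I_sq]
  push_cast
  ring_nf

lemma quad_add_act (A B : Mat d) (c x : E d) :
    quad A c (c + act B x) = x.ofLp ⬝ᵥ (Bᵀ * A * B) *ᵥ x.ofLp := by
  simp only [quad, add_sub_cancel_left, ofLp_act]
  rw [← mulVec_mulVec, ← mulVec_mulVec, dotProduct_mulVec x.ofLp, vecMul_transpose]

lemma map_add_act_volume {B : Mat d} (hB : 0 < B.det) (c : E d) :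
    (volume : Measure (E d)).map (fun x ↦ c + act B x) = ENNReal.ofReal (B.det)⁻¹ • volume := by
  have hdet : LinearMap.det (toEuclideanLin B) = B.det := by
    change LinearMap.det (toLpLin 2 2 B) = B.det
    rw [toLpLin_eq_toLin, LinearMap.det_toLin]
  have h := Measure.map_linearMap_addHaar_eq_smul_addHaar (volume : Measure (E d))
    (f := toEuclideanLin B) (by rw [hdet]; exact hB.ne')
  rw [hdet, abs_of_pos (inv_pos.2 hB)] at h
  have hf : (fun x ↦ c + act B x) = (fun x ↦ c + x) ∘ (toEuclideanLin B) := rfl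
  have hm : Measurable (toEuclideanLin B : E d → E d) := (continuous_act B).measurable
  rw [hf, ← Measure.map_map (by fun_prop) hm, h, Measure.map_smul, map_add_left_eq_self]

lemma logDensity_add_act_sqrt {τ : Mat d} (hτ : τ.PosDef) (μ x : E d) :
    logDensity 0 1 x =
      logDensity μ τ (μ + act (CFC.sqrt τ) x) + Real.log (CFC.sqrt τ).det := by
  have hs := posDef_sqrt hτ
  have h1 : CFC.sqrt τ * τ⁻¹ * CFC.sqrt τ = 1 := by
    nth_rw 2 [← sqrt_mul_self hτ]
    rw [Matrix.mul_inv_rev, ← mul_assoc, mul_nonsing_inv _ (isUnit_det_of_posDef hs), one_mul,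
      nonsing_inv_mul _ (isUnit_det_of_posDef hs)]
  have h2 : Real.log τ.det = 2 * Real.log (CFC.sqrt τ).det := by
    conv_lhs => rw [← sqrt_mul_self hτ]
    rw [det_mul, Real.log_mul hs.det_pos.ne' hs.det_pos.ne']
    ring
  unfold logDensity
  rw [quad_add_act, transpose_sqrt, h1, h2]
  simp only [quad, inv_one, sub_zero, det_one, Real.log_one]
  ring

/-- The density of a nondegenerate Gaussian law. -/
lemma multivariateGaussian_eq_withDensity {τ : Mat d} (hτ : τ.PosDef) (μ : E d) :
    multivariateGaussian μ τ =
      volume.withDensity fun y ↦ ENNReal.ofReal (Real.exp (logDensity μ τ y)) := by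
  have hs := (posDef_sqrt hτ).det_pos
  have hf : Measurable (fun x ↦ μ + act (CFC.sqrt τ) x) := by fun_prop
  change (stdGaussian (E d)).map (fun x ↦ μ + act (CFC.sqrt τ) x) = _
  ext s hms
  rw [Measure.map_apply hf hms, stdGaussian_eq_withDensity, withDensity_apply _ (hf hms),
    withDensity_apply _ hms]
  have h (x : E d) : ENNReal.ofReal (Real.exp (logDensity 0 1 x)) =
      ENNReal.ofReal (CFC.sqrt τ).det *
        ENNReal.ofReal (Real.exp (logDensity μ τ (μ + act (CFC.sqrt τ) x))) := by
    rw [← ENNReal.ofReal_mul hs.le, logDensity_add_act_sqrt hτ μ, Real.exp_add, Real.exp_log hs,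
      mul_comm]
  simp_rw [h]
  rw [lintegral_const_mul _ (by fun_prop),
    ← setLIntegral_map (μ := volume) hms
      (f := fun y ↦ ENNReal.ofReal (Real.exp (logDensity μ τ y))) (by fun_prop) hf,
    map_add_act_volume hs, Measure.restrict_smul, lintegral_smul_measure, smul_eq_mul, ← mul_assoc,
    ← ENNReal.ofReal_mul hs.le, mul_inv_cancel₀ hs.ne', ENNReal.ofReal_one, one_mul]

lemma multivariateGaussian_absolutelyContinuous {τ : Mat d} (hτ : τ.PosDef) (μ : E d) :
    multivariateGaussian μ τ ≪ volume := by
  rw [multivariateGaussian_eq_withDensity hτ]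
  exact withDensity_absolutelyContinuous _ _

/-- A Radon–Nikodym derivative is fixed only almost everywhere; this suffices because the laws it is
integrated against are absolutely continuous. -/
lemma potential_multivariateGaussian {τ : Mat d} (hτ : τ.PosDef) (μ : E d) :
    potential (multivariateGaussian μ τ) =ᵐ[volume] fun y ↦ -logDensity μ τ y := by
  have h := Measure.rnDeriv_withDensity (volume : Measure (E d))
    (f := fun y ↦ ENNReal.ofReal (Real.exp (logDensity μ τ y))) (by fun_prop)
  rw [← multivariateGaussian_eq_withDensity hτ] at h
  filter_upwards [h] with y hy
  rw [potential, hy, ENNReal.toReal_ofReal (Real.exp_nonneg _), Real.log_exp]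

lemma integrable_logDensity (μ : E d) (τ : Mat d) (m : E d) (σ : Mat d) :
    Integrable (logDensity μ τ) (multivariateGaussian m σ) :=
  ((integrable_const _).add (integrable_quad _ _ _ _)).const_mul _

lemma integral_logDensity {σ : Mat d} (hσ : σ.PosSemidef) (μ : E d) (τ : Mat d) (m : E d) :
    ∫ y, logDensity μ τ y ∂(multivariateGaussian m σ) =
      -(1 / 2) * (d * Real.log (2 * Real.pi) + Real.log τ.det + (τ⁻¹ * σ).trace +
        quad τ⁻¹ μ m) := by
  unfold logDensity
  rw [integral_const_mul, integral_add (integrable_const _) (integrable_quad _ _ _ _),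
    integral_quad hσ]
  simp only [integral_const, probReal_univ, one_smul]
  ring

lemma integrable_potential {τ σ : Mat d} (hτ : τ.PosDef) (hσ : σ.PosDef) (μ m : E d) :
    Integrable (potential (multivariateGaussian μ τ)) (multivariateGaussian m σ) :=
  (integrable_logDensity μ τ m σ).neg.congr
    ((multivariateGaussian_absolutelyContinuous hσ m).ae_eq
      (potential_multivariateGaussian hτ μ)).symm

lemma integral_potential_self {τ : Mat d} (hτ : τ.PosDef) (μ : E d) :
    ∫ y, potential (multivariateGaussian μ τ) y ∂(multivariateGaussian μ τ) =
      1 / 2 * (d * Real.log (2 * Real.pi) + Real.log τ.det + d) := by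
  rw [integral_congr_ae ((multivariateGaussian_absolutelyContinuous hτ μ).ae_eq
    (potential_multivariateGaussian hτ μ)), integral_neg, integral_logDensity hτ.posSemidef,
    nonsing_inv_mul _ (isUnit_det_of_posDef hτ), trace_one, Fintype.card_fin]
  simp only [quad, sub_self, WithLp.ofLp_zero, mulVec_zero, dotProduct_zero]
  ring

end Density

/-! ### Relative entropy of the joint laws. -/

section Entropy

variable {d : ℕ} {m : E d} {σ : Mat d}

/-- The log-density of `P_θ` with respect to `ν_{m,σ} ⊗ dy`. -/
noncomputable def logKernel (θ : Param d) (z : E d × E d) : ℝ :=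
  logDensity (θ.α + act θ.β z.1) θ.τ z.2

@[fun_prop]
lemma continuous_logKernel (θ : Param d) : Continuous (logKernel θ) := by
  unfold logKernel logDensity quad
  simp only [dotProduct, mulVec]
  fun_prop

/-- The reference measure `ν_{m,σ} ⊗ dy` does not depend on `θ`, so log-likelihood ratios are
differences of `logKernel`. -/
lemma jointLaw_eq_withDensity (m : E d) (σ : Mat d) (θ : Param d) :
    jointLaw m σ θ = ((multivariateGaussian m σ).prod volume).withDensity
      fun z ↦ ENNReal.ofReal (Real.exp (logKernel θ z)) := by
  ext s hs
  rw [jointLaw, Measure.compProd_apply hs, withDensity_apply _ hs, ← lintegral_indicator hs,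
    lintegral_prod _ (by fun_prop (disch := exact hs))]
  refine lintegral_congr fun x ↦ ?_
  rw [kernel_apply, multivariateGaussian_eq_withDensity θ.posDef_τ,
    withDensity_apply _ (measurable_prodMk_left hs),
    ← lintegral_indicator (measurable_prodMk_left hs)]
  rfl

instance (m : E d) (σ : Mat d) (θ : Param d) : IsProbabilityMeasure (jointLaw m σ θ) := by
  unfold jointLaw; infer_instance

lemma jointLaw_eq_withDensity_jointLaw (m : E d) (σ : Mat d) (θ₁ θ : Param d) :
    jointLaw m σ θ₁ = (jointLaw m σ θ).withDensity
      fun z ↦ ENNReal.ofReal (Real.exp (logKernel θ₁ z - logKernel θ z)) := by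
  rw [jointLaw_eq_withDensity m σ θ, ← withDensity_mul _ (by fun_prop) (by fun_prop),
    jointLaw_eq_withDensity m σ θ₁]
  congr 1
  ext z
  rw [Pi.mul_apply, ← ENNReal.ofReal_mul (Real.exp_nonneg _), ← Real.exp_add, add_sub_cancel]

lemma jointLaw_absolutelyContinuous (m : E d) (σ : Mat d) (θ₁ θ : Param d) :
    jointLaw m σ θ₁ ≪ jointLaw m σ θ := by
  rw [jointLaw_eq_withDensity_jointLaw m σ θ₁ θ]
  exact withDensity_absolutelyContinuous _ _

lemma llr_jointLaw (m : E d) (σ : Mat d) (θ₁ θ : Param d) :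
    llr (jointLaw m σ θ₁) (jointLaw m σ θ) =ᵐ[jointLaw m σ θ₁]
      fun z ↦ logKernel θ₁ z - logKernel θ z := by
  have h := Measure.rnDeriv_withDensity (jointLaw m σ θ)
    (f := fun z ↦ ENNReal.ofReal (Real.exp (logKernel θ₁ z - logKernel θ z))) (by fun_prop)
  rw [← jointLaw_eq_withDensity_jointLaw] at h
  filter_upwards [(jointLaw_absolutelyContinuous m σ θ₁ θ).ae_eq h] with z hz
  rw [llr, hz, ENNReal.toReal_ofReal (Real.exp_nonneg _), Real.log_exp]

lemma quad_nonneg {A : Mat d} (hA : A.PosSemidef) (c x : E d) : 0 ≤ quad A c x := by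
  exact hA.dotProduct_mulVec_nonneg (x - c).ofLp

/-- The transition quadratic form integrated against `K_{θ₁}`. -/
lemma integral_quad_kernel (A : Mat d) (θ₁ θ : Param d) (x : E d) :
    ∫ y, quad A (θ.α + act θ.β x) y ∂(kernel θ₁ x) =
      (A * θ₁.τ).trace + quad A (θ.α - θ₁.α) (act (θ₁.β - θ.β) x) := by
  rw [kernel_apply, integral_quad θ₁.posDef_τ.posSemidef]
  have : θ₁.α + act θ₁.β x - (θ.α + act θ.β x) = act (θ₁.β - θ.β) x - (θ.α - θ₁.α) := by
    have : act (θ₁.β - θ.β) x = act θ₁.β x - act θ.β x := by simp [act]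
    rw [this]
    abel
  rw [quad, quad, this]

lemma integrable_quad_act (A B : Mat d) (hσ : σ.PosSemidef) (c : E d) :
    Integrable (fun x ↦ quad A c (act B x)) (multivariateGaussian m σ) := by
  have h := map_add_act_multivariateGaussian hσ m 0 B
  simp only [zero_add] at h
  have h2 := integrable_quad A c (act B m) (B * σ * Bᵀ)
  rw [← h] at h2
  exact h2.comp_measurable (by fun_prop)

lemma integral_quad_act (A B : Mat d) (hσ : σ.PosSemidef) (c : E d) :
    ∫ x, quad A c (act B x) ∂(multivariateGaussian m σ) =
      (A * (B * σ * Bᵀ)).trace + quad A c (act B m) := by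
  have h := map_add_act_multivariateGaussian hσ m 0 B
  simp only [zero_add] at h
  rw [← integral_quad (posSemidef_mul_mul_transpose hσ B), ← h,
    integral_map (by fun_prop) (by fun_prop)]

lemma integrable_quad_jointLaw {A : Mat d} (hA : A.PosSemidef) (hσ : σ.PosSemidef)
    (θ₁ θ : Param d) :
    Integrable (fun z ↦ quad A (θ.α + act θ.β z.1) z.2) (jointLaw m σ θ₁) := by
  have hc : Continuous (fun z : E d × E d ↦ quad A (θ.α + act θ.β z.1) z.2) := by
    unfold quad
    simp only [dotProduct, mulVec]
    fun_prop
  rw [jointLaw, Measure.integrable_compProd_iff hc.aestronglyMeasurable]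
  refine ⟨ae_of_all _ fun x ↦ ?_, ?_⟩
  · exact integrable_quad A (θ.α + act θ.β x) (θ₁.α + act θ₁.β x) θ₁.τ
  · simp_rw [Real.norm_of_nonneg (quad_nonneg hA _ _), integral_quad_kernel]
    exact (integrable_const _).add (integrable_quad_act _ _ hσ _)

lemma integral_quad_jointLaw {A : Mat d} (hA : A.PosSemidef) (hσ : σ.PosSemidef)
    (θ₁ θ : Param d) :
    ∫ z, quad A (θ.α + act θ.β z.1) z.2 ∂(jointLaw m σ θ₁) =
      (A * θ₁.τ).trace + ((A * ((θ₁.β - θ.β) * σ * (θ₁.β - θ.β)ᵀ)).trace +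
        quad A (θ.α + act θ.β m) (θ₁.α + act θ₁.β m)) := by
  rw [jointLaw, Measure.integral_compProd (integrable_quad_jointLaw hA hσ θ₁ θ)]
  simp_rw [integral_quad_kernel]
  rw [integral_add (integrable_const _) (integrable_quad_act _ _ hσ _), integral_quad_act _ _ hσ]
  have : act (θ₁.β - θ.β) m - (θ.α - θ₁.α) = θ₁.α + act θ₁.β m - (θ.α + act θ.β m) := by
    have : act (θ₁.β - θ.β) m = act θ₁.β m - act θ.β m := by simp [act]
    rw [this]
    abel
  simp only [quad, this, integral_const, probReal_univ, one_smul]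

lemma integrable_logKernel (hσ : σ.PosSemidef) (θ₁ θ : Param d) :
    Integrable (logKernel θ) (jointLaw m σ θ₁) :=
  ((integrable_const _).add
    (integrable_quad_jointLaw θ.posDef_τ.inv.posSemidef hσ θ₁ θ)).const_mul _

lemma integral_logKernel (hσ : σ.PosSemidef) (θ₁ θ : Param d) :
    ∫ z, logKernel θ z ∂(jointLaw m σ θ₁) = -(1 / 2) * (d * Real.log (2 * Real.pi) +
      Real.log θ.τ.det + ((θ.τ⁻¹ * θ₁.τ).trace +
        ((θ.τ⁻¹ * ((θ₁.β - θ.β) * σ * (θ₁.β - θ.β)ᵀ)).trace +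
          quad θ.τ⁻¹ (θ.α + act θ.β m) (θ₁.α + act θ₁.β m)))) := by
  unfold logKernel logDensity
  rw [integral_const_mul, integral_add (integrable_const _)
    (integrable_quad_jointLaw θ.posDef_τ.inv.posSemidef hσ θ₁ θ),
    integral_quad_jointLaw θ.posDef_τ.inv.posSemidef hσ]
  simp only [integral_const, probReal_univ, one_smul]

/-- The relative entropy of the joint laws is finite. -/
lemma klDiv_jointLaw (hσ : σ.PosSemidef) (θ₁ θ : Param d) :
    InformationTheory.klDiv (jointLaw m σ θ₁) (jointLaw m σ θ) =
      ENNReal.ofReal (gaussianEnt m σ θ₁ θ) ∧ 0 ≤ gaussianEnt m σ θ₁ θ := by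
  have hac := jointLaw_absolutelyContinuous m σ θ₁ θ
  have hi : Integrable (llr (jointLaw m σ θ₁) (jointLaw m σ θ)) (jointLaw m σ θ₁) :=
    ((integrable_logKernel hσ θ₁ θ₁).sub (integrable_logKernel hσ θ₁ θ)).congr
      (llr_jointLaw m σ θ₁ θ).symm
  have h : ∫ z, llr (jointLaw m σ θ₁) (jointLaw m σ θ) z ∂(jointLaw m σ θ₁) =
      gaussianEnt m σ θ₁ θ := by
    rw [integral_congr_ae (llr_jointLaw m σ θ₁ θ), integral_sub (integrable_logKernel hσ θ₁ θ₁)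
      (integrable_logKernel hσ θ₁ θ), integral_logKernel hσ, integral_logKernel hσ,
      nonsing_inv_mul _ (isUnit_det_of_posDef θ₁.posDef_τ)]
    simp only [gaussianEnt, quad, sub_self, WithLp.ofLp_zero, mulVec_zero, dotProduct_zero,
      transpose_zero, mul_zero, trace_zero, trace_one, Fintype.card_fin]
    ring
  -- Nonnegativity of the closed form is read off from that of relative entropy; it ensures that
  -- `ENNReal.ofReal` does not truncate.
  have h1 := InformationTheory.integral_llr_add_sub_measure_univ_nonneg hac hi
  rw [h] at h1
  refine ⟨?_, by simpa using h1⟩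
  rw [InformationTheory.klDiv_of_ac_of_integrable hac hi, h]
  simp

end Entropy

/-! ### The quadratic Wasserstein distance of Gaussian laws -/

section Wasserstein

variable {d : ℕ}

/-- Needed because the dual lower bound for the transport cost may take negative values. -/
lemma ofReal_integral_le_lintegral_ofReal {X : Type*} [MeasurableSpace X] {μ : Measure X}
    {f : X → ℝ} (hf : Integrable f μ) :
    ENNReal.ofReal (∫ x, f x ∂μ) ≤ ∫⁻ x, ENNReal.ofReal (f x) ∂μ := by
  calc ENNReal.ofReal (∫ x, f x ∂μ)
      ≤ ENNReal.ofReal (∫ x, max (f x) 0 ∂μ) :=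
        ENNReal.ofReal_le_ofReal (integral_mono hf hf.pos_part fun x ↦ le_max_left _ _)
    _ = ∫⁻ x, ENNReal.ofReal (max (f x) 0) ∂μ :=
        ofReal_integral_eq_lintegral_ofReal hf.pos_part (ae_of_all _ fun x ↦ le_max_right _ _)
    _ = ∫⁻ x, ENNReal.ofReal (f x) ∂μ := by simp

lemma quad_one (x y : E d) : quad 1 y x = ‖x - y‖ ^ 2 := by
  simp only [quad, one_mulVec, EuclideanSpace.real_norm_sq_eq, dotProduct, ← sq]

lemma edist_rpow_two (x y : E d) : edist x y ^ (2 : ℝ) = ENNReal.ofReal (quad 1 y x) := by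
  rw [edist_dist, ENNReal.ofReal_rpow_of_nonneg dist_nonneg (by norm_num), quad_one, dist_eq_norm,
    Real.rpow_two]

/-- The squared quadratic Wasserstein distance of `ν_{m₁,u}` and `ν_{m₂,v}`. -/
noncomputable def wassersteinSq (m₁ m₂ : E d) (u v : Mat d) : ℝ :=
  quad 1 m₂ m₁ + u.trace + v.trace - 2 * (geomMean u v⁻¹ * v).trace

/-- Young's inequality for the transport matrix `T`. -/
lemma quad_transport_le {T : Mat d} (hT : T.PosDef) (m₁ m₂ x y : E d) :
    quad 1 m₂ x - quad T⁻¹ m₁ x + (quad 1 m₁ y - quad T m₂ y) - quad 1 m₂ m₁ ≤ quad 1 y x := by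
  have h := hT.inv.posSemidef.dotProduct_mulVec_nonneg ((x - m₁).ofLp - T *ᵥ (y - m₂).ofLp)
  have hTt := transpose_eq_of_isHermitian hT.isHermitian
  have hu := isUnit_det_of_posDef hT
  have h1 : star ((x - m₁).ofLp - T *ᵥ (y - m₂).ofLp) ⬝ᵥ
      T⁻¹ *ᵥ ((x - m₁).ofLp - T *ᵥ (y - m₂).ofLp) =
      quad T⁻¹ m₁ x + quad T m₂ y - 2 * ((x - m₁).ofLp ⬝ᵥ (y - m₂).ofLp) := by
    have h2 : T *ᵥ (y - m₂).ofLp ⬝ᵥ T⁻¹ *ᵥ (x - m₁).ofLp =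
        (x - m₁).ofLp ⬝ᵥ (y - m₂).ofLp := by
      rw [dotProduct_comm, ← vecMul_transpose, transpose_nonsing_inv, hTt, ← dotProduct_mulVec,
        mulVec_mulVec, nonsing_inv_mul _ hu, one_mulVec]
    rw [star_trivial, mulVec_sub, mulVec_mulVec, nonsing_inv_mul _ hu, one_mulVec,
      sub_dotProduct, dotProduct_sub, dotProduct_sub, h2, quad, quad,
      dotProduct_comm (T *ᵥ _) (y - m₂).ofLp]
    ring
  rw [h1] at h
  -- This isolates the only coupled term `(x - m₁) · (y - m₂)`; the nonnegative square above bounds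
  -- it by a function of `x` plus a function of `y`.
  have h3 : quad 1 y x = quad 1 m₂ x + quad 1 m₁ y - quad 1 m₂ m₁ -
      2 * ((x - m₁).ofLp ⬝ᵥ (y - m₂).ofLp) := by
    simp only [quad, one_mulVec, dotProduct, Finset.mul_sum, ← Finset.sum_sub_distrib,
      ← Finset.sum_add_distrib, WithLp.ofLp_sub, Pi.sub_apply]
    refine Finset.sum_congr rfl fun i _ ↦ ?_
    ring
  linarith

variable {u v : Mat d}

lemma trace_geomMean_inv_inv_mul (hu : u.PosDef) (hv : v.PosDef) :
    ((geomMean u v⁻¹)⁻¹ * u).trace = (geomMean u v⁻¹ * v).trace := by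
  nth_rw 2 [← geomMean_inv_mul_mul hu hv]
  rw [mul_assoc, nonsing_inv_mul_cancel_left _ _ (isUnit_det_of_posDef (posDef_geomMean_inv hu hv)),
    trace_mul_comm]

/-- Weak Kantorovich duality: the lower bound of `quad_transport_le` splits into functions of `x`
and of `y`, so its integral depends only on the marginals. -/
lemma wassersteinSq_le_of_coupling (hu : u.PosDef) (hv : v.PosDef) (m₁ m₂ : E d)
    {π : Measure (E d × E d)} (h₁ : π.fst = multivariateGaussian m₁ u)
    (h₂ : π.snd = multivariateGaussian m₂ v) :
    ENNReal.ofReal (wassersteinSq m₁ m₂ u v) ≤ ∫⁻ z, edist z.1 z.2 ^ (2 : ℝ) ∂π := by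
  have hT := posDef_geomMean_inv hu hv
  have hprob : IsProbabilityMeasure π := ⟨by rw [← Measure.fst_univ, h₁]; exact measure_univ⟩
  have hF0 : Integrable (fun x ↦ quad 1 m₂ x - quad (geomMean u v⁻¹)⁻¹ m₁ x)
    (multivariateGaussian m₁ u) := (integrable_quad _ _ _ _).sub (integrable_quad _ _ _ _)
  have hG0 : Integrable (fun y ↦ quad 1 m₁ y - quad (geomMean u v⁻¹) m₂ y)
    (multivariateGaussian m₂ v) := (integrable_quad _ _ _ _).sub (integrable_quad _ _ _ _)
  have hF : Integrable (fun z ↦ quad 1 m₂ z.1 - quad (geomMean u v⁻¹)⁻¹ m₁ z.1) π := by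
    rw [← h₁] at hF0
    exact hF0.comp_measurable measurable_fst
  have hG : Integrable (fun z ↦ quad 1 m₁ z.2 - quad (geomMean u v⁻¹) m₂ z.2) π := by
    rw [← h₂] at hG0
    exact hG0.comp_measurable measurable_snd
  have hadd : Integrable (fun z ↦ quad 1 m₂ z.1 - quad (geomMean u v⁻¹)⁻¹ m₁ z.1 +
    (quad 1 m₁ z.2 - quad (geomMean u v⁻¹) m₂ z.2)) π := hF.add hG
  have hFG : ∫ z, (quad 1 m₂ z.1 - quad (geomMean u v⁻¹)⁻¹ m₁ z.1 +
      (quad 1 m₁ z.2 - quad (geomMean u v⁻¹) m₂ z.2) - quad 1 m₂ m₁) ∂π =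
      wassersteinSq m₁ m₂ u v := by
    rw [integral_sub hadd (integrable_const _), integral_add hF hG,
      ← integral_map (μ := π) (f := fun x ↦ quad 1 m₂ x - quad (geomMean u v⁻¹)⁻¹ m₁ x)
        measurable_fst.aemeasurable (by fun_prop),
      ← integral_map (μ := π) (f := fun y ↦ quad 1 m₁ y - quad (geomMean u v⁻¹) m₂ y)
        measurable_snd.aemeasurable (by fun_prop)]
    change ∫ x, _ ∂π.fst + ∫ y, _ ∂π.snd - _ = _
    rw [h₁, h₂, integral_sub (integrable_quad _ _ _ _) (integrable_quad _ _ _ _),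
      integral_sub (integrable_quad _ _ _ _) (integrable_quad _ _ _ _),
      integral_quad hu.posSemidef, integral_quad hu.posSemidef, integral_quad hv.posSemidef,
      integral_quad hv.posSemidef, trace_geomMean_inv_inv_mul hu hv, wassersteinSq]
    have h0 (A : Mat d) (c : E d) : quad A c c = 0 := by simp [quad]
    have h1 : quad 1 m₁ m₂ = quad 1 m₂ m₁ := by rw [quad_one, quad_one, norm_sub_rev]
    simp only [h0, h1, one_mul, integral_const, probReal_univ, one_smul]
    ring
  rw [← hFG]
  refine (ofReal_integral_le_lintegral_ofReal (hadd.sub (integrable_const _))).trans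
    (lintegral_mono fun z ↦ ?_)
  rw [edist_rpow_two]
  exact ENNReal.ofReal_le_ofReal (quad_transport_le hT m₁ m₂ z.1 z.2)

/-- The linear transport map is an optimal coupling. -/
lemma exists_coupling_wassersteinSq (hu : u.PosDef) (hv : v.PosDef) (m₁ m₂ : E d) :
    ∃ π : Measure (E d × E d), (π.fst = multivariateGaussian m₁ u ∧
      π.snd = multivariateGaussian m₂ v) ∧
      ∫⁻ z, edist z.1 z.2 ^ (2 : ℝ) ∂π = ENNReal.ofReal (wassersteinSq m₁ m₂ u v) := by
  set T := geomMean u v⁻¹ with hTdef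
  have hT : T.PosDef := posDef_geomMean_inv hu hv
  have hTt := transpose_eq_of_isHermitian hT.isHermitian
  have hTv : T * v * T = u := geomMean_inv_mul_mul hu hv
  -- The transport map is `y ↦ m₁ + T (y - m₂)`.
  set c := m₁ - act T m₂ with hc
  have hf : Measurable (fun y : E d ↦ c + act T y) := by fun_prop
  have hg : Measurable (fun y : E d ↦ (c + act T y, y)) := by fun_prop
  refine ⟨(multivariateGaussian m₂ v).map (fun y ↦ (c + act T y, y)), ⟨?_, ?_⟩, ?_⟩
  · rw [Measure.fst, Measure.map_map measurable_fst hg]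
    change (multivariateGaussian m₂ v).map (fun y ↦ c + act T y) = _
    rw [map_add_act_multivariateGaussian hv.posSemidef, hTt, hTv, hc, sub_add_cancel]
  · rw [Measure.snd, Measure.map_map measurable_snd hg]
    exact Measure.map_id
  · rw [lintegral_map (by fun_prop) hg]
    have hq (y : E d) : quad 1 y (c + act T y) = quad 1 (-c) (act (T - 1) y) := by
      have : c + act T y - y = act (T - 1) y - -c := by
        have : act (T - 1) y = act T y - y := by simp [act]
        rw [this]; abel
      rw [quad, quad, this]
    simp_rw [edist_rpow_two, hq]
    rw [← ofReal_integral_eq_lintegral_ofReal (integrable_quad_act _ _ hv.posSemidef _)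
      (ae_of_all _ fun y ↦ quad_nonneg PosSemidef.one _ _), integral_quad_act _ _ hv.posSemidef]
    congr 1
    have hm : quad 1 (-c) (act (T - 1) m₂) = quad 1 m₂ m₁ := by
      rw [← hq, hc, sub_add_cancel]
    have htr : (v * T).trace = (T * v).trace := trace_mul_comm _ _
    rw [hm, wassersteinSq, ← hTdef, transpose_sub, transpose_one, hTt]
    simp only [sub_mul, mul_sub, one_mul, mul_one, trace_sub, hTv, htr]
    ring

lemma wasserstein_two_multivariateGaussian (hu : u.PosDef) (hv : v.PosDef) (m₁ m₂ : E d) :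
    wasserstein 2 (multivariateGaussian m₁ u) (multivariateGaussian m₂ v) =
      ENNReal.ofReal (wassersteinSq m₁ m₂ u v) ^ (1 / 2 : ℝ) := by
  refine le_antisymm ?_ (le_iInf₂ fun π hπ ↦ ?_)
  · obtain ⟨π, hπ, h⟩ := exists_coupling_wassersteinSq hu hv m₁ m₂
    rw [← h]
    exact iInf₂_le π hπ
  · exact ENNReal.rpow_le_rpow (wassersteinSq_le_of_coupling hu hv m₁ m₂ hπ.1 hπ.2) (by norm_num)

/-- The covariance part is the trace of `(T - 1) v (T - 1)'`. -/
lemma wassersteinSq_nonneg (hu : u.PosDef) (hv : v.PosDef) (m₁ m₂ : E d) :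
    0 ≤ wassersteinSq m₁ m₂ u v := by
  have hT := posDef_geomMean_inv hu hv
  have hTt := transpose_eq_of_isHermitian hT.isHermitian
  have h := (posSemidef_mul_mul_transpose hv.posSemidef
    (geomMean u v⁻¹ - 1)).trace_nonneg
  have htr : (v * geomMean u v⁻¹).trace = (geomMean u v⁻¹ * v).trace := trace_mul_comm _ _
  rw [transpose_sub, transpose_one, hTt] at h
  simp only [sub_mul, mul_sub, one_mul, mul_one, trace_sub, htr, geomMean_inv_mul_mul hu hv] at h
  have h2 := quad_nonneg (PosSemidef.one (n := Fin d) (R := ℝ)) m₂ m₁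
  rw [wassersteinSq]
  linarith

lemma toReal_wasserstein_two_sq (hu : u.PosDef) (hv : v.PosDef) (m₁ m₂ : E d) :
    (wasserstein 2 (multivariateGaussian m₁ u) (multivariateGaussian m₂ v)).toReal ^ 2 =
      wassersteinSq m₁ m₂ u v := by
  have h := wassersteinSq_nonneg hu hv m₁ m₂
  rw [wasserstein_two_multivariateGaussian hu hv, ← ENNReal.toReal_rpow, ENNReal.toReal_ofReal h,
    ← Real.sqrt_eq_rpow, Real.sq_sqrt h]

end Wasserstein

/-! ### The entropic cost of the bridge -/

section Bridge

variable {d : ℕ} {σ σbar : Mat d}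

lemma bridgeArgmin_eq (m mbar : E d) (hσ : σ.PosDef) (hσbar : σbar.PosDef) (θ : Param d) :
    bridgeArgmin m σ mbar σbar θ = {bridge m mbar hσ hσbar θ} := by
  have hS := bridge_mem_admissible m mbar hσ hσbar θ
  have hv := posDef_varsigma hσ hσbar θ
  ext θ₁
  refine ⟨fun ⟨h₁, hmin⟩ ↦ ?_, ?_⟩
  · have hle := hmin hS
    simp only [Set.mem_ofPred_eq] at hle
    rw [(klDiv_jointLaw hσ.posSemidef θ₁ θ).1, (klDiv_jointLaw hσ.posSemidef _ θ).1,
      ENNReal.ofReal_le_ofReal_iff (klDiv_jointLaw hσ.posSemidef _ θ).2] at hle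
    have hgap := gaussianEnt_bridge_add_le hσ hσbar h₁ θ
    have hnn := trace_mul_nonneg (posSemidef_mul_mul_transpose hσ.posSemidef
      (θ₁.β - bridgeβ σ σbar θ)) hv.inv.posSemidef
    -- A minimizer has no entropy excess over the bridge, so the quadratic gap vanishes and the
    -- regression matrices agree.
    have h0 := eq_zero_of_trace_mul_eq_zero hσ hv.inv (le_antisymm (by linarith) hnn)
    exact admissible_ext h₁ hS (sub_eq_zero.1 h0)
  · rintro rfl
    refine ⟨hS, fun θ₂ h₂ ↦ ?_⟩
    simp only [Set.mem_ofPred_eq]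
    rw [(klDiv_jointLaw hσ.posSemidef θ₂ θ).1, (klDiv_jointLaw hσ.posSemidef _ θ).1]
    refine ENNReal.ofReal_le_ofReal ?_
    have hgap := gaussianEnt_bridge_add_le hσ hσbar h₂ θ
    have hnn := trace_mul_nonneg (posSemidef_mul_mul_transpose hσ.posSemidef
      (θ₂.β - bridgeβ σ σbar θ)) hv.inv.posSemidef
    linarith

lemma kernel_comp_of_admissible {m mbar : E d} (hσ : σ.PosDef) {θ₁ : Param d}
    (h₁ : θ₁ ∈ admissible m σ mbar σbar) :
    kernel θ₁ ∘ₘ multivariateGaussian m σ = multivariateGaussian mbar σbar := by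
  rw [kernel_comp_multivariateGaussian hσ.posSemidef, h₁.1, h₁.2]

lemma entropicCost_of_admissible {m mbar : E d} (hσ : σ.PosDef) (hσbar : σbar.PosDef)
    {θ₁ : Param d} (h₁ : θ₁ ∈ admissible m σ mbar σbar) (θ : Param d) :
    entropicCost m σ mbar σbar θ₁ θ = gaussianEnt m σ θ₁ θ +
      1 / 2 * (d * Real.log (2 * Real.pi) + Real.log σbar.det + d) := by
  obtain ⟨h, hnn⟩ := klDiv_jointLaw (m := m) hσ.posSemidef θ₁ θ
  rw [entropicCost, h, ENNReal.toReal_ofReal hnn, kernel_comp_of_admissible hσ h₁,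
    integral_potential_self hσbar]

lemma log_det_smul {A : Mat d} (hA : A.PosDef) {s : ℝ} (hs : 0 < s) :
    Real.log (s • A).det = d * Real.log s + Real.log A.det := by
  rw [det_smul, Fintype.card_fin, Real.log_mul (pow_pos hs d).ne' hA.det_pos.ne', Real.log_pow]

/-- The small noise expansion in closed form. -/
lemma mul_entropicCost_bridge_sub (m mbar : E d) (hσ : σ.PosDef) (hσbar : σbar.PosDef)
    (α : E d) {β : Mat d} (hβ : IsUnit β) {t : ℝ} (ht : 0 < t) :
    t * entropicCost m σ mbar σbar (bridge m mbar hσ hσbar (refParam α β hβ t ht))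
        (refParam α β hβ t ht) -
      1 / 2 * wassersteinSq mbar (α + act β m) σbar (sigmaBeta σ β) =
    ((geomMean σbar (sigmaBeta σ β)⁻¹ -
        t⁻¹ • varsigma σ σbar (refParam α β hβ t ht)) * sigmaBeta σ β).trace +
      t / 2 * (d * Real.log (2 * Real.pi) -
        Real.log (t⁻¹ • rMat σ σbar (refParam α β hβ t ht)).det) := by
  set θ := refParam α β hβ t ht with hθ
  have hS := bridge_mem_admissible m mbar hσ hσbar θ
  rw [entropicCost_of_admissible hσ hσbar hS, gaussianEnt_of_admissible hσ hS]
  have hinv : θ.τ⁻¹ = t⁻¹ • (1 : Mat d) := refParam_inv hβ ht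
  have hvt := transpose_eq_of_isHermitian (posDef_varsigma hσ hσbar θ).isHermitian
  -- One factor `t⁻¹` is `τ⁻¹` itself, the other sits inside the bridge regression matrix.
  have hcross : (θ.τ⁻¹ * (θ.β * σ * (bridge m mbar hσ hσbar θ).βᵀ)).trace =
      t⁻¹ * (t⁻¹ * (varsigma σ σbar θ * sigmaBeta σ β).trace) := by
    change (θ.τ⁻¹ * (β * σ * (varsigma σ σbar θ * θ.τ⁻¹ * β)ᵀ)).trace = _
    simp only [hinv, transpose_mul, hvt, transpose_smul, smul_mul_assoc,
      mul_smul_comm, one_mul, mul_one, trace_smul, smul_eq_mul, sigmaBeta]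
    rw [trace_mul_comm (varsigma σ σbar θ), mul_assoc (β * σ)]
  have hτ : Real.log θ.τ.det = d * Real.log t := by
    change Real.log (t • (1 : Mat d)).det = _
    rw [log_det_smul PosDef.one ht, det_one, Real.log_one, add_zero]
  have hq : (mbar - (θ.α + act θ.β m)).ofLp ⬝ᵥ θ.τ⁻¹ *ᵥ (mbar - (θ.α + act θ.β m)).ofLp =
      t⁻¹ * quad 1 (α + act β m) mbar := by
    rw [hinv, smul_mulVec, dotProduct_smul, smul_eq_mul]
    rfl
  have hv : Real.log (bridge m mbar hσ hσbar θ).τ.det =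
      Real.log σbar.det + Real.log (rMat σ σbar θ).det := log_det_varsigma hσ hσbar θ
  rw [hcross, hτ, hq, hv, log_det_smul (posDef_rMat hσ hσbar θ) (inv_pos.2 ht), Real.log_inv,
    wassersteinSq, hinv]
  change _ * (1 / 2 * ((t⁻¹ • (1 : Mat d) * σbar).trace +
    (t⁻¹ • (1 : Mat d) * sigmaBeta σ β).trace - _ - _ + _ - _ + _) + _) - _ = _
  simp only [smul_mul_assoc, one_mul, trace_smul, smul_eq_mul, sub_mul, trace_sub]
  field_simp
  ring

end Bridge

end GaussianBridge

theorem theorem3p4 {d : ℕ} (m mbar : E d) (σ σbar : Mat d) (hσ : σ.PosDef) (hσbar : σbar.PosDef)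
    (α : E d) (β : Mat d) (hβ : IsUnit β) :
    -- the bridge map `t ↦ S(θ(t))` is well defined by its variational problem
    ∃ S : ℝ → Param d,
      (∀ (t : ℝ) (ht : 0 < t),
        bridgeArgmin m σ mbar σbar (refParam α β hβ t ht) = {S t}) ∧
      -- all the quantities below are finite
      (∀ (t : ℝ) (ht : 0 < t),
        InformationTheory.klDiv (jointLaw m σ (S t)) (jointLaw m σ (refParam α β hβ t ht)) ≠ ∞ ∧
        Integrable (potential (multivariateGaussian mbar σbar))
          (kernel (S t) ∘ₘ multivariateGaussian m σ)) ∧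
      wasserstein 2 (multivariateGaussian mbar σbar)
        (multivariateGaussian (α + act β m) (sigmaBeta σ β)) ≠ ∞ ∧
      -- the closed form
      (∀ (t : ℝ) (ht : 0 < t),
        t * entropicCost m σ mbar σbar (S t) (refParam α β hβ t ht) -
            1 / 2 * (wasserstein 2 (multivariateGaussian mbar σbar)
              (multivariateGaussian (α + act β m) (sigmaBeta σ β))).toReal ^ 2 =
          ((geomMean σbar (sigmaBeta σ β)⁻¹ -
              t⁻¹ • varsigma σ σbar (refParam α β hβ t ht)) * sigmaBeta σ β).trace +
            t / 2 * (d * Real.log (2 * Real.pi) -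
              Real.log (t⁻¹ • rMat σ σbar (refParam α β hβ t ht)).det)) ∧
      -- the rate as `t → 0`
      ∃ c t₀ : ℝ, 0 < t₀ ∧ ∀ (t : ℝ) (ht : 0 < t), t ≤ t₀ →
        |t * entropicCost m σ mbar σbar (S t) (refParam α β hβ t ht) -
            1 / 2 * (wasserstein 2 (multivariateGaussian mbar σbar)
              (multivariateGaussian (α + act β m) (sigmaBeta σ β))).toReal ^ 2| ≤ c * t := by
  have hs := posDef_sigmaBeta hσ hβ
  -- The value for `t ≤ 0` is an arbitrary parameter; no conclusion concerns it.
  let S (t : ℝ) : Param d := if ht : 0 < t then bridge m mbar hσ hσbar (refParam α β hβ t ht)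
    else refParam α β hβ 1 one_pos
  have hS (t : ℝ) (ht : 0 < t) : S t = bridge m mbar hσ hσbar (refParam α β hβ t ht) :=
    dif_pos ht
  have hform (t : ℝ) (ht : 0 < t) := mul_entropicCost_bridge_sub m mbar hσ hσbar α hβ ht
  refine ⟨S, fun t ht ↦ ?_, fun t ht ↦ ⟨?_, ?_⟩, ?_, fun t ht ↦ ?_, ?_⟩
  · rw [hS t ht, bridgeArgmin_eq m mbar hσ hσbar]
  · rw [(klDiv_jointLaw hσ.posSemidef _ _).1]
    exact ENNReal.ofReal_ne_top
  · rw [hS t ht, kernel_comp_of_admissible hσ (bridge_mem_admissible m mbar hσ hσbar _)]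
    exact integrable_potential hσbar hσbar _ _
  · rw [wasserstein_two_multivariateGaussian hσbar hs]
    exact ENNReal.rpow_ne_top_of_nonneg (by norm_num) ENNReal.ofReal_ne_top
  · rw [hS t ht, toReal_wasserstein_two_sq hσbar hs, hform t ht]
  · obtain ⟨c, hc⟩ := exists_rate hσ hσbar α hβ
    -- `t₀ = 1` is the range on which the bound for `-log det Y` is uniform.
    refine ⟨c, 1, one_pos, fun t ht ht1 ↦ ?_⟩
    rw [hS t ht, toReal_wasserstein_two_sq hσbar hs, hform t ht]
    exact hc t ht ht1
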